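/- For $D\ge 1$, $p>1$ and a bounded open convex set $\Omega\subset\mathbb R^D$, let $u_p\in W_0^{1,p}(\Omega)$ be the $p$-torsion function of $\Omega$, i.e. the unique weak solution of $-\operatorname{div}(|\nabla u|^{p-2}\nabla u)=1$ in $\Omega$, $u=0$ on $\partial\Omega$. Put \[ T_p(\Omega)=\int_\Omega u_p\,dx,\qquad T(p;\Omega)=|\Omega|^{p-1}\,T_p(\Omega)^{1-p},\qquad Q_p(\Omega)=\left(\frac{T(p;\Omega)\,R_\Omega^{\,p}}{\left(\frac{2p-1}{p-1}\right)^{p-1}}\right)^{1/p}, \] where $|\Omega|$ is the Lebesgue measure and $R_\Omega$ is the inradius of $\Omega$ (the supremum of the radii of balls contained in $\Omega$). For a family $\mathcal F$ of such sets put $\gamma_{\mathcal F}(p)=\inf_{\Omega\in\mathcal F}Q_p(\Omega)\big/\sup_{\Omega\in\mathcal F}Q_p(\Omega)$. For $\kappa\ge 2$ let \[ \mathcal R_\kappa=\{(0,L)\times(0,2R)\subset\mathbb R^2 : R>0,\ L>0,\ L/R\ge\kappa\}. \] Proposition. Let $p>1$ and $\kappa\ge2$ be real numbers. Then $1\le Q_p(\Omega)<1+\frac2\kappa$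 for every $\Omega\in\mathcal R_\kappa$, and \[ \gamma_{\mathcal R_\kappa}(p)\ \ge\ \frac{\kappa}{\kappa+2}. \] -/

import Mathlib

open scoped ContDiff

noncomputable section

namespace PTorsion

open MeasureTheory Filter Topology

/-- `D`-dimensional Euclidean space. -/
abbrev E (D : ℕ) : Type := EuclideanSpace ℝ (Fin D)

/-- `φ ∈ C_c^∞(Ω)`. -/
def IsTestFunction {D : ℕ} (Ω : Set (E D)) (φ : E D → ℝ) : Prop :=
  ContDiff ℝ ∞ φ ∧ HasCompactSupport φ ∧ tsupport φ ⊆ Ω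

/-- `G` is the weak (distributional) gradient of `u` on `Ω`:
`∫_Ω u ∇φ = - ∫_Ω φ G` for all `φ ∈ C_c^∞(Ω)`. -/
def IsWeakGradient {D : ℕ} (Ω : Set (E D)) (u : E D → ℝ) (G : E D → E D) : Prop :=
  ∀ φ : E D → ℝ, IsTestFunction Ω φ →
    ∫ x in Ω, u x • gradient φ x = - ∫ x in Ω, φ x • G x

/-- `u ∈ W^{1,p}(Ω)` with weak gradient `G`. Only the values on `Ω` matter. -/
def MemW {D : ℕ} (p : ℝ) (Ω : Set (E D)) (u : E D → ℝ) (G : E D → E D) : Prop :=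
  MemLp u (ENNReal.ofReal p) (volume.restrict Ω) ∧
  MemLp G (ENNReal.ofReal p) (volume.restrict Ω) ∧
  IsWeakGradient Ω u G

/-- `u ∈ W_0^{1,p}(Ω)` with weak gradient `G`: `u` is in the closure of `C_c^∞(Ω)`
in the norm of `W^{1,p}(Ω)`. -/
def MemWZero {D : ℕ} (p : ℝ) (Ω : Set (E D)) (u : E D → ℝ) (G : E D → E D) : Prop :=
  MemW p Ω u G ∧
  ∃ φ : ℕ → E D → ℝ, (∀ n, IsTestFunction Ω (φ n)) ∧
    Tendsto (fun n => eLpNorm (fun x => φ n x - u x) (ENNReal.ofReal p) (volume.restrict Ω))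
      atTop (𝓝 0) ∧
    Tendsto (fun n => eLpNorm (fun x => gradient (φ n) x - G x) (ENNReal.ofReal p)
      (volume.restrict Ω)) atTop (𝓝 0)

/-- `u` is a `p`-torsion function on `Ω`: a weak solution `u ∈ W_0^{1,p}(Ω)` of `-Δ_p u = 1` in
`Ω`, `u = 0` on `∂Ω`, that is
`∫_Ω |∇u|^{p-2} ⟨∇u, ∇v⟩ = ∫_Ω v` for all `v ∈ W_0^{1,p}(Ω)`. -/
def IsTorsionFunction {D : ℕ} (p : ℝ) (Ω : Set (E D)) (u : E D → ℝ) : Prop :=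
  ∃ G : E D → E D, MemWZero p Ω u G ∧
    ∀ (v : E D → ℝ) (H : E D → E D), MemWZero p Ω v H →
      ∫ x in Ω, ‖G x‖ ^ (p - 2) * inner ℝ (G x) (H x) = ∫ x in Ω, v x

open Classical in
/-- The `p`-torsion function `u_p` of `Ω` (unique up to null sets for `1 < p` and bounded open
`Ω`; the value `0` is used only if there is no weak solution). -/
def torsionFunction {D : ℕ} (p : ℝ) (Ω : Set (E D)) : E D → ℝ :=
  if h : ∃ u : E D → ℝ, IsTorsionFunction p Ω u then h.choose else 0

/-- The `p`-torsional rigidity `T_p(Ω) = ∫_Ω u_p`. -/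
def torsionalRigidity {D : ℕ} (p : ℝ) (Ω : Set (E D)) : ℝ :=
  ∫ x in Ω, torsionFunction p Ω x

/-- The normalized `p`-torsional rigidity `T(p;Ω) = |Ω|^{p-1} T_p(Ω)^{1-p}`. -/
def normalizedRigidity {D : ℕ} (p : ℝ) (Ω : Set (E D)) : ℝ :=
  (volume Ω).toReal ^ (p - 1) * torsionalRigidity p Ω ^ (1 - p)

/-- The inradius: the supremum of the radii of balls contained in `Ω`. -/
def inradius {D : ℕ} (Ω : Set (E D)) : ℝ :=
  sSup {r : ℝ | 0 ≤ r ∧ ∃ x : E D, Metric.ball x r ⊆ Ω}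

/-- The scale-invariant quantity `Q_p(Ω)`. -/
def Q {D : ℕ} (p : ℝ) (Ω : Set (E D)) : ℝ :=
  (normalizedRigidity p Ω * inradius Ω ^ p / ((2 * p - 1) / (p - 1)) ^ (p - 1)) ^ (1 / p)

/-- `α_F(p) = inf_{Ω ∈ F} Q_p(Ω)`. -/
def familyInf {D : ℕ} (F : Set (Set (E D))) (p : ℝ) : ℝ := sInf (Q p '' F)

/-- `β_F(p) = sup_{Ω ∈ F} Q_p(Ω)`. -/
def familySup {D : ℕ} (F : Set (Set (E D))) (p : ℝ) : ℝ := sSup (Q p '' F)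

/-- `γ_F(p) = α_F(p) / β_F(p)`. -/
def familyRatio {D : ℕ} (F : Set (Set (E D))) (p : ℝ) : ℝ := familyInf F p / familySup F p

/-- The open planar rectangle `(0,L) × (0,2R)`. -/
def rectangle (R L : ℝ) : Set (E 2) :=
  {x | x 0 ∈ Set.Ioo 0 L ∧ x 1 ∈ Set.Ioo 0 (2 * R)}

/-- The family of rectangles `(0,L) × (0,2R)` with `L / R ≥ κ`. -/
def rectangleFamily (κ : ℝ) : Set (Set (E 2)) :=
  {Ω | ∃ R L : ℝ, 0 < R ∧ 0 < L ∧ κ ≤ L / R ∧ Ω = rectangle R L}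

end PTorsion

end

open scoped ContDiff

namespace PTorsion

open MeasureTheory Filter Topology

/-! ### Test functions, integration by parts and passage to the limit. -/

section

variable {D : ℕ} {p : ℝ} {Ω : Set (E D)}

/-! Let q = p/(p-1), let T be the p-torsional rigidity of the rectangle and S = 2LR^(q+1)/(q+1), the
value of ∫ |x₁ - R|^q. Since (2p-1)/(p-1) = q+1 and the inradius is R, the definition collapses to
Q_p = (S/T)^(1/q) (`Q_rectangle`). So T must be compared with S.

T ≤ S: integrating u against the linear function x₁ - R gives T = -∫ (x₁ - R) ∂₁u, and Hölder
together with the energy identity ∫ |∇u|^p = ∫ u yields T ≤ S^(1/q) T^(1/p)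
(`integral_le_integral_coord_rpow_of_weak_solution`). Hence Q_p ≥ 1.

S < T (1 + 2R/L)^q: the competitor is w(d), with d the distance to the boundary and w the torsion
profile of the strip of half-width R. Its gradient satisfies |∇w(d)|^p = (R - d)^q almost
everywhere. With V = ∫ w(d) and W = ∫ (R - d)^q, testing the equation and Hölder give V ≤ T^(1/q)
W^(1/p), that is V^q ≤ T W^(q-1) (`integral_stripProfile_depth_le`). Explicit integration gives S <
W ≤ V (1 + 2R/L), and the bound follows. Since L/R ≥ κ, this is Q_p < 1 + 2/κ, and the bound on the
ratio is immediate.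

Two matters need work. Existence of a weak solution is proved by the direct method, with uniform
convexity of L^p in place of weak compactness. The function w(d) is not smooth, so it is
approximated by test functions built from a soft minimum of the distances to the four sides and a
smooth ramp. -/

theorem gradient_eq_toDual_symm_comp_fderiv (φ : E D → ℝ) :
    gradient φ = (InnerProductSpace.toDual ℝ (E D)).symm ∘ fderiv ℝ φ := rfl

theorem norm_gradient (φ : E D → ℝ) (x : E D) : ‖gradient φ x‖ = ‖fderiv ℝ φ x‖ := by
  simp [gradient]

theorem continuous_gradient {φ : E D → ℝ} (h : ContDiff ℝ 1 φ) : Continuous (gradient φ) := by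
  rw [gradient_eq_toDual_symm_comp_fderiv]
  exact (LinearIsometryEquiv.continuous _).comp (h.continuous_fderiv one_ne_zero)

theorem gradient_eq_zero_of_notMem_tsupport {φ : E D → ℝ} {x : E D} (hx : x ∉ tsupport φ) :
    gradient φ x = 0 := by
  have : fderiv ℝ φ x = 0 := fderiv_of_notMem_tsupport ℝ hx
  simp [gradient, this]

theorem hasCompactSupport_gradient {φ : E D → ℝ} (h : HasCompactSupport φ) :
    HasCompactSupport (gradient φ) := by
  rw [gradient_eq_toDual_symm_comp_fderiv]
  exact (h.fderiv (𝕜 := ℝ)).comp_left (map_zero _)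

theorem inner_gradient (φ : E D → ℝ) (x e : E D) : inner ℝ e (gradient φ x) = fderiv ℝ φ x e := by
  rw [real_inner_comm]
  exact inner_gradient_left ..

/-- Integration by parts on the whole space. -/
theorem integral_smul_gradient {φ h : E D → ℝ} (hφ : ContDiff ℝ 1 φ) (hc : HasCompactSupport φ)
    (hh : ContDiff ℝ 1 h) : ∫ x, φ x • gradient h x = - ∫ x, h x • gradient φ x := by
  have cφ := hφ.continuous
  have ch := hh.continuous
  have i1 : Integrable (fun x => φ x • gradient h x) :=
    (cφ.smul (continuous_gradient hh)).integrable_of_hasCompactSupport hc.smul_right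
  have i2 : Integrable (fun x => h x • gradient φ x) :=
    (ch.smul (continuous_gradient hφ)).integrable_of_hasCompactSupport
      (hasCompactSupport_gradient hc).smul_left
  refine ext_inner_left ℝ fun e => ?_
  rw [inner_neg_right, ← integral_inner i1, ← integral_inner i2]
  simp only [inner_smul_right, inner_gradient]
  refine integral_mul_fderiv_eq_neg_fderiv_mul_of_integrable (v := e) ?_ ?_ ?_
    (fun x _ => hφ.differentiable one_ne_zero x) (fun x _ => hh.differentiable one_ne_zero x)
    |>.trans ?_
  · refine Continuous.integrable_of_hasCompactSupport ?_ ?_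
    · exact ((hφ.continuous_fderiv one_ne_zero).clm_apply continuous_const).mul ch
    · exact ((hc.fderiv (𝕜 := ℝ)).comp_left (g := fun L : E D →L[ℝ] ℝ => L e) rfl).mul_right
  · exact Continuous.integrable_of_hasCompactSupport
      (cφ.mul ((hh.continuous_fderiv one_ne_zero).clm_apply continuous_const)) hc.mul_right
  · exact Continuous.integrable_of_hasCompactSupport (cφ.mul ch) hc.mul_right
  · simp only [mul_comm]

theorem setIntegral_eq_integral_of_tsupport_subset {F : Type*} [NormedAddCommGroup F]
    [NormedSpace ℝ F] {φ : E D → ℝ} (hs : tsupport φ ⊆ Ω) {f : E D → F}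
    (hf : ∀ x, x ∉ tsupport φ → f x = 0) : ∫ x in Ω, f x = ∫ x, f x :=
  setIntegral_eq_integral_of_forall_compl_eq_zero fun x hx => hf x fun h => hx (hs h)

theorem IsTestFunction.contDiff_one {φ : E D → ℝ} (h : IsTestFunction Ω φ) : ContDiff ℝ 1 φ :=
  h.1.of_le (by exact_mod_cast le_top)

theorem IsTestFunction.continuous {φ : E D → ℝ} (h : IsTestFunction Ω φ) : Continuous φ :=
  h.1.continuous

theorem IsTestFunction.continuous_gradient {φ : E D → ℝ} (h : IsTestFunction Ω φ) :
    Continuous (gradient φ) :=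
  PTorsion.continuous_gradient h.contDiff_one

theorem IsTestFunction.setIntegral_smul_gradient {φ h : E D → ℝ} (hφ : IsTestFunction Ω φ)
    (hh : ContDiff ℝ 1 h) : ∫ x in Ω, φ x • gradient h x = - ∫ x in Ω, h x • gradient φ x := by
  rw [setIntegral_eq_integral_of_tsupport_subset hφ.2.2, setIntegral_eq_integral_of_tsupport_subset
    hφ.2.2, integral_smul_gradient hφ.contDiff_one hφ.2.1 hh]
  · exact fun x hx => by simp [gradient_eq_zero_of_notMem_tsupport hx]
  · exact fun x hx => by simp [image_eq_zero_of_notMem_tsupport hx]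

theorem IsTestFunction.memLp {φ : E D → ℝ} (h : IsTestFunction Ω φ) (r : ENNReal) :
    MemLp φ r (volume.restrict Ω) :=
  (h.continuous.memLp_of_hasCompactSupport h.2.1).restrict Ω

theorem IsTestFunction.memLp_gradient {φ : E D → ℝ} (h : IsTestFunction Ω φ) (r : ENNReal) :
    MemLp (gradient φ) r (volume.restrict Ω) :=
  (h.continuous_gradient.memLp_of_hasCompactSupport (hasCompactSupport_gradient h.2.1)).restrict Ω

theorem IsTestFunction.memWZero {φ : E D → ℝ} (h : IsTestFunction Ω φ) :
    MemWZero p Ω φ (gradient φ) := by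
  refine ⟨⟨h.memLp _, h.memLp_gradient _, fun ψ hψ => ?_⟩, fun _ => φ, fun _ => h, ?_, ?_⟩
  · exact h.setIntegral_smul_gradient hψ.contDiff_one
  · simp
  · simp

theorem IsTestFunction.gradient_add {φ ψ : E D → ℝ} (hφ : IsTestFunction Ω φ)
    (hψ : IsTestFunction Ω ψ) : gradient (φ + ψ) = gradient φ + gradient ψ := by
  ext1 x
  simp only [gradient, Pi.add_apply]
  rw [fderiv_add (hφ.contDiff_one.differentiable one_ne_zero x)
    (hψ.contDiff_one.differentiable one_ne_zero x), map_add]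

theorem IsTestFunction.gradient_smul {φ : E D → ℝ} (hφ : IsTestFunction Ω φ) (c : ℝ) :
    gradient (c • φ) = c • gradient φ := by
  ext1 x
  simp only [gradient, Pi.smul_apply]
  rw [fderiv_const_smul (hφ.contDiff_one.differentiable one_ne_zero x)]
  simp

theorem IsTestFunction.add {φ ψ : E D → ℝ} (hφ : IsTestFunction Ω φ)
    (hψ : IsTestFunction Ω ψ) : IsTestFunction Ω (φ + ψ) :=
  ⟨hφ.1.add hψ.1, hφ.2.1.add hψ.2.1,
    (tsupport_add φ ψ).trans (Set.union_subset hφ.2.2 hψ.2.2)⟩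

theorem IsTestFunction.smul {φ : E D → ℝ} (hφ : IsTestFunction Ω φ) (c : ℝ) :
    IsTestFunction Ω (c • φ) :=
  ⟨contDiff_const.smul hφ.1, hφ.2.1.smul_left (f := fun _ => c),
    (tsupport_smul_subset_right (fun _ => c) φ).trans hφ.2.2⟩

theorem isTestFunction_zero : IsTestFunction Ω (0 : E D → ℝ) :=
  ⟨contDiff_const, HasCompactSupport.zero, by simp [tsupport]⟩

/-- `L^p` convergence implies convergence of integrals against a bounded multiplier. -/
theorem tendsto_integral_smul_of_tendsto_eLpNorm {α F G : Type*} [MeasurableSpace α]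
    {μ : Measure α} [IsFiniteMeasure μ] [NormedAddCommGroup F] [NormedSpace ℝ F]
    [NormedAddCommGroup G] [NormedSpace ℝ G] {r : ENNReal} (hr : 1 ≤ r)
    {f : ℕ → α → F} {g : α → F} (hf : ∀ n, MemLp (f n) r μ) (hg : MemLp g r μ)
    (h : Tendsto (fun n => eLpNorm (fun x => f n x - g x) r μ) atTop (𝓝 0))
    {B : α → F →L[ℝ] G} {M : NNReal} (hB : ∀ᵐ x ∂μ, ‖B x‖ ≤ M)
    (hBf : ∀ f : α → F, AEStronglyMeasurable f μ →
      AEStronglyMeasurable (fun x => B x (f x)) μ) :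
    Tendsto (fun n => ∫ x, B x (f n x) ∂μ) atTop (𝓝 (∫ x, B x (g x) ∂μ)) := by
  have key : ∀ f : α → F, MemLp f r μ → Integrable (fun x => B x (f x)) μ := fun f hf => by
    refine ((hf.integrable hr).norm.const_mul (M : ℝ)).mono' (hBf f hf.1) ?_
    filter_upwards [hB] with x hx
    exact ((B x).le_opNorm _).trans (by gcongr)
  refine tendsto_integral_of_L1' _ (key g hg).1 (.of_forall fun n => key _ (hf n)) ?_
  have h1 : Tendsto (fun n => (M : ENNReal) * (eLpNorm (fun x => f n x - g x) r μ *
      μ Set.univ ^ (1 / ENNReal.toReal 1 - 1 / r.toReal))) atTop (𝓝 0) := by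
    have := ENNReal.Tendsto.const_mul (a := (M : ENNReal)) (ENNReal.Tendsto.mul_const
      (b := μ Set.univ ^ (1 / ENNReal.toReal 1 - 1 / r.toReal)) h (Or.inr ?_))
      (Or.inr ENNReal.coe_ne_top)
    · simpa using this
    · refine ENNReal.rpow_ne_top_of_nonneg ?_ (measure_ne_top _ _)
      -- The exponent 1 - 1/r is nonnegative, so the factor is finite. For r = ⊤, `toReal` gives 0
      -- and 1/0 = 0, so the exponent is 1.
      rcases eq_or_ne r ⊤ with rfl | h'
      · simp
      · have : 1 ≤ r.toReal := by
          simpa using ENNReal.toReal_mono h' hr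
        simp only [ENNReal.toReal_one, div_one, one_div, sub_nonneg]
        exact inv_le_one_of_one_le₀ this
  refine tendsto_of_tendsto_of_tendsto_of_le_of_le tendsto_const_nhds h1 (fun _ => zero_le)
    fun n => ?_
  have h2 : eLpNorm ((fun x => B x (f n x)) - fun x => B x (g x)) 1 μ ≤
      (M : ENNReal) * eLpNorm (fun x => f n x - g x) 1 μ := by
    refine eLpNorm_le_nnreal_smul_eLpNorm_of_ae_le_mul (c := M) ?_ 1
    filter_upwards [hB] with x hx
    rw [Pi.sub_apply, ← map_sub]
    exact ((B x).le_opNorm _).trans (by simpa using by gcongr)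
  refine h2.trans ?_
  gcongr
  exact eLpNorm_le_eLpNorm_mul_rpow_measure_univ hr ((hf n).1.sub hg.1)

/-- Integration by parts for a `W^{1,p}`-limit of test functions. -/
theorem integral_smul_gradient_of_tendsto [IsFiniteMeasure (volume.restrict Ω)] {r : ENNReal}
    (hr : 1 ≤ r) {φ : ℕ → E D → ℝ} {u : E D → ℝ} {G : E D → E D}
    (hφ : ∀ n, IsTestFunction Ω (φ n)) (hu : MemLp u r (volume.restrict Ω))
    (hG : MemLp G r (volume.restrict Ω))
    (h1 : Tendsto (fun n => eLpNorm (fun x => φ n x - u x) r (volume.restrict Ω)) atTop (𝓝 0))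
    (h2 : Tendsto (fun n => eLpNorm (fun x => gradient (φ n) x - G x) r (volume.restrict Ω))
      atTop (𝓝 0)) {h : E D → ℝ} (hh : ContDiff ℝ 1 h) {M : NNReal}
    (hM : ∀ᵐ x ∂volume.restrict Ω, ‖h x‖ ≤ M ∧ ‖gradient h x‖ ≤ M) :
    ∫ x in Ω, u x • gradient h x = - ∫ x in Ω, h x • G x := by
  have t1 := tendsto_integral_smul_of_tendsto_eLpNorm hr (fun n => (hφ n).memLp r) hu h1
    (B := fun x => (ContinuousLinearMap.id ℝ ℝ).smulRight (gradient h x)) (M := M)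
    (hM.mono fun x hx => by
      simpa [ContinuousLinearMap.norm_smulRight_apply] using hx.2)
    (fun f hf => hf.smul (continuous_gradient hh).aestronglyMeasurable)
  have t2 := tendsto_integral_smul_of_tendsto_eLpNorm hr (fun n => (hφ n).memLp_gradient r) hG h2
    (B := fun x => h x • ContinuousLinearMap.id ℝ (E D)) (M := M)
    (hM.mono fun x hx => by
      refine (norm_smul_le (h x) (ContinuousLinearMap.id ℝ (E D))).trans ?_
      exact (mul_le_of_le_one_right (norm_nonneg _) ContinuousLinearMap.norm_id_le).trans hx.1)
    (fun f hf => hh.continuous.aestronglyMeasurable.smul hf)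
  refine tendsto_nhds_unique t1 (t2.neg.congr fun n => ?_)
  exact ((hφ n).setIntegral_smul_gradient hh).symm

/-- A test function and its gradient are bounded, so integration by parts survives the limit. Limits
of test pairs therefore carry a weak gradient automatically. -/
theorem isWeakGradient_of_tendsto [IsFiniteMeasure (volume.restrict Ω)] {r : ENNReal}
    (hr : 1 ≤ r) {φ : ℕ → E D → ℝ} {u : E D → ℝ} {G : E D → E D}
    (hφ : ∀ n, IsTestFunction Ω (φ n)) (hu : MemLp u r (volume.restrict Ω))
    (hG : MemLp G r (volume.restrict Ω))
    (h1 : Tendsto (fun n => eLpNorm (fun x => φ n x - u x) r (volume.restrict Ω)) atTop (𝓝 0))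
    (h2 : Tendsto (fun n => eLpNorm (fun x => gradient (φ n) x - G x) r (volume.restrict Ω))
      atTop (𝓝 0)) : IsWeakGradient Ω u G := by
  intro ψ hψ
  obtain ⟨C, hC⟩ := hψ.continuous.bounded_above_of_compact_support hψ.2.1
  obtain ⟨C', hC'⟩ := hψ.continuous_gradient.bounded_above_of_compact_support
    (hasCompactSupport_gradient hψ.2.1)
  refine integral_smul_gradient_of_tendsto hr hφ hu hG h1 h2 hψ.contDiff_one
    (M := (max C C').toNNReal) (.of_forall fun x => ?_)
  have := Real.le_coe_toNNReal (max C C')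
  exact ⟨(hC x).trans ((le_max_left _ _).trans this), (hC' x).trans ((le_max_right _ _).trans this)⟩

end

/-! ### Poincaré inequality on sets of bounded width in one coordinate. -/

section

variable {D : ℕ} {p : ℝ} {Ω : Set (E D)}

theorem hasGradientAt_coord_sub (i : Fin D) (c : ℝ) (x : E D) :
    HasGradientAt (fun y : E D => y i - c) (EuclideanSpace.single i (1 : ℝ)) x := by
  rw [hasGradientAt_iff_hasFDerivAt]
  have h := (EuclideanSpace.proj (𝕜 := ℝ) i : E D →L[ℝ] ℝ).hasFDerivAt (x := x) |>.sub_const c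
  refine h.congr_fderiv ?_
  ext y
  simp [EuclideanSpace.inner_single_left]

theorem gradient_coord_sub (i : Fin D) (c : ℝ) (x : E D) :
    gradient (fun y : E D => y i - c) x = EuclideanSpace.single i (1 : ℝ) :=
  (hasGradientAt_coord_sub i c x).gradient

theorem contDiff_coord_sub (i : Fin D) (c : ℝ) {n : WithTop ℕ∞} :
    ContDiff ℝ n (fun y : E D => y i - c) :=
  (EuclideanSpace.proj (𝕜 := ℝ) i : E D →L[ℝ] ℝ).contDiff.sub contDiff_const

/-- The coordinate x_i - c has constant gradient e_i. Applied to g = |φ|^p, this is the source of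
the Poincaré inequality. -/
theorem integral_eq_neg_integral_coord_mul {g : E D → ℝ} (hg : ContDiff ℝ 1 g)
    (hc : HasCompactSupport g) (i : Fin D) (c : ℝ) :
    ∫ x, g x = - ∫ x, (x i - c) * fderiv ℝ g x (EuclideanSpace.single i (1 : ℝ)) := by
  have h := integral_smul_gradient hg hc (contDiff_coord_sub i c)
  simp only [gradient_coord_sub] at h
  have h2 := congrArg (inner ℝ (EuclideanSpace.single i (1 : ℝ))) h
  have i1 : Integrable g := hg.continuous.integrable_of_hasCompactSupport hc
  have i2 : Integrable (fun x : E D => (x i - c) • gradient g x) :=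
    ((contDiff_coord_sub i c (n := 0)).continuous.smul
      (continuous_gradient hg)).integrable_of_hasCompactSupport
      (hasCompactSupport_gradient hc).smul_left
  rw [inner_neg_right, ← integral_inner (i1.smul_const _), ← integral_inner i2] at h2
  simpa [inner_smul_right, inner_gradient] using h2

/-- Poincaré inequality for test functions on a set of finite width. -/
theorem IsTestFunction.integral_norm_rpow_le (hp : 1 < p) {i : Fin D} {c ρ : ℝ}
    (hΩ : ∀ x ∈ Ω, |x i - c| ≤ ρ) (hρ : 0 ≤ ρ) {φ : E D → ℝ} (hφ : IsTestFunction Ω φ) :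
    ∫ x in Ω, ‖φ x‖ ^ p ≤ (ρ * p) ^ p * ∫ x in Ω, ‖gradient φ x‖ ^ p := by
  have hp0 : 0 < p := by linarith
  have hpq := Real.HolderConjugate.conjExponent hp
  set q := p.conjExponent with hq
  have := hpq.symm.ennrealOfReal
  have z1 : ∀ x, x ∉ tsupport φ → ‖φ x‖ ^ p = 0 := fun x hx => by
    rw [image_eq_zero_of_notMem_tsupport hx, norm_zero, Real.zero_rpow hp0.ne']
  have z2 : ∀ x, x ∉ tsupport φ → ‖gradient φ x‖ ^ p = 0 := fun x hx => by
    rw [gradient_eq_zero_of_notMem_tsupport hx, norm_zero, Real.zero_rpow hp0.ne']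
  rw [setIntegral_eq_integral_of_tsupport_subset hφ.2.2 z1,
    setIntegral_eq_integral_of_tsupport_subset hφ.2.2 z2]
  have hg : ContDiff ℝ 1 (fun x => ‖φ x‖ ^ p) := (contDiff_norm_rpow hp).comp hφ.contDiff_one
  have hgc : HasCompactSupport (fun x => ‖φ x‖ ^ p) :=
    hφ.2.1.comp_left (g := fun y : ℝ => ‖y‖ ^ p) (by simp [Real.zero_rpow hp0.ne'])
  have hgg := hasCompactSupport_gradient hφ.2.1
  have mφ : MemLp (fun x => ‖φ x‖ ^ (p - 1)) (ENNReal.ofReal q) volume := by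
    refine Continuous.memLp_of_hasCompactSupport ?_ ?_
    · exact hφ.continuous.norm.rpow_const fun _ => Or.inr (by linarith)
    · exact hφ.2.1.comp_left (g := fun y : ℝ => ‖y‖ ^ (p - 1))
        (by simp [Real.zero_rpow (by linarith : p - 1 ≠ 0)])
  have mg : MemLp (fun x => ‖gradient φ x‖) (ENNReal.ofReal p) volume :=
    (hφ.continuous_gradient.memLp_of_hasCompactSupport hgg).norm
  -- Here |∇|φ|^p| ≤ p |φ|^(p-1) |∇φ|. The bound |x_i - c| ≤ ρ is available only in Ω; off the
  -- support of φ the derivative vanishes.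
  have hle : ∫ x, ‖φ x‖ ^ p ≤ (ρ * p) * ∫ x, ‖φ x‖ ^ (p - 1) * ‖gradient φ x‖ := by
    rw [integral_eq_neg_integral_coord_mul hg hgc i c, ← integral_neg, ← integral_const_mul]
    refine (le_abs_self _).trans ((Real.norm_eq_abs _).symm.le.trans
      (norm_integral_le_of_norm_le ((mφ.integrable_mul mg).const_mul _) (.of_forall fun x => ?_)))
    by_cases hx : x ∈ tsupport φ
    · rw [norm_neg, norm_mul, mul_assoc]
      refine mul_le_mul (hΩ x (hφ.2.2 hx)) ?_ (norm_nonneg _) hρ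
      refine (ContinuousLinearMap.le_opNorm _ _).trans ?_
      rw [PiLp.norm_single, norm_one, mul_one, norm_gradient, ← mul_assoc]
      exact norm_fderiv_norm_rpow_le (hφ.contDiff_one.differentiable one_ne_zero) hp
    · have : x ∉ tsupport fun x => ‖φ x‖ ^ p := by
        refine fun h => hx <| closure_mono (fun y hy => ?_) h
        refine fun hy' => (Function.mem_support.1 hy) ?_
        rw [hy', norm_zero, Real.zero_rpow hp0.ne']
      rw [fderiv_of_notMem_tsupport ℝ this]
      simp only [zero_apply, mul_zero, neg_zero, norm_zero]
      positivity
  have hH := integral_mul_le_Lp_mul_Lq_of_nonneg (μ := volume) hpq.symm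
    (.of_forall fun x => by positivity) (.of_forall fun x => by positivity) mφ mg
  have e1 : ∀ x, (‖φ x‖ ^ (p - 1)) ^ q = ‖φ x‖ ^ p := fun x => by
    rw [← Real.rpow_mul (norm_nonneg _), hpq.sub_one_mul_conj]
  simp only [e1] at hH
  set A := ∫ x, ‖φ x‖ ^ p with hA
  set B := ∫ x, ‖gradient φ x‖ ^ p with hB
  have hA0 : 0 ≤ A := integral_nonneg fun x => by positivity
  have hB0 : 0 ≤ B := integral_nonneg fun x => by positivity
  rcases hA0.eq_or_lt with h0 | h0
  · rw [← h0]; positivity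
  have h3 : A ≤ (ρ * p) * (A ^ (1 / q) * B ^ (1 / p)) := hle.trans (by gcongr)
  -- Cancel A^(1/q), using 1/p + 1/q = 1.
  have h4 : A ^ (1 / p) ≤ (ρ * p) * B ^ (1 / p) := by
    have hs : A ^ (1 / q) * A ^ (1 / p) = A := by
      rw [← Real.rpow_add h0, one_div, one_div, add_comm, hpq.inv_add_inv_eq_one, Real.rpow_one]
    have hpos : 0 < A ^ (1 / q) := Real.rpow_pos_of_pos h0 _
    refine le_of_mul_le_mul_left ?_ hpos
    rw [hs]
    linarith
  have h5 := Real.rpow_le_rpow (by positivity) h4 hp0.le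
  rwa [Real.mul_rpow (by positivity) (by positivity), ← Real.rpow_mul hA0, ← Real.rpow_mul hB0,
    one_div_mul_cancel hp0.ne', Real.rpow_one, Real.rpow_one] at h5

end

/-! ### Uniform convexity of the p-th power of a Euclidean norm. -/

section

/-- Qualitative uniform convexity of `‖·‖ ^ p`. -/
theorem exists_norm_sub_rpow_le {F : Type*} [NormedAddCommGroup F] [InnerProductSpace ℝ F]
    [FiniteDimensional ℝ F] {p : ℝ} (hp : 1 < p) {ε : ℝ} (hε : 0 < ε) :
    ∃ C : ℝ, 0 ≤ C ∧ ∀ a b : F, ‖a - b‖ ^ p ≤ ε * (‖a‖ ^ p + ‖b‖ ^ p) +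
      C * ((‖a‖ ^ p + ‖b‖ ^ p) / 2 - ‖(2 : ℝ)⁻¹ • (a + b)‖ ^ p) := by
  have hp0 : 0 < p := by linarith
  have hcv := strictConvexOn_rpow hp
  have le_one : ∀ {a : F}, ‖a‖ ^ p ≤ 1 → ‖a‖ ≤ 1 := fun h => by
    by_contra! h'
    exact absurd (Real.one_lt_rpow h' hp0) (not_lt.2 h)
  have gap_nonneg : ∀ a b : F, 0 ≤ (‖a‖ ^ p + ‖b‖ ^ p) / 2 - ‖(2 : ℝ)⁻¹ • (a + b)‖ ^ p := by
    intro a b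
    have h1 : ‖(2 : ℝ)⁻¹ • (a + b)‖ ≤ 2⁻¹ * ‖a‖ + 2⁻¹ * ‖b‖ := by
      rw [norm_smul, ← mul_add]
      simpa using norm_add_le a b
    have h2 := hcv.convexOn.2 (norm_nonneg a : ‖a‖ ∈ Set.Ici 0) (norm_nonneg b : ‖b‖ ∈ Set.Ici 0)
      (by norm_num : (0 : ℝ) ≤ 2⁻¹) (by norm_num : (0 : ℝ) ≤ 2⁻¹) (by norm_num)
    simp only [smul_eq_mul] at h2
    have h3 := Real.rpow_le_rpow (norm_nonneg _) h1 hp0.le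
    linarith
  have gap_pos : ∀ a b : F, a ≠ b →
      0 < (‖a‖ ^ p + ‖b‖ ^ p) / 2 - ‖(2 : ℝ)⁻¹ • (a + b)‖ ^ p := by
    intro a b hab
    -- For equal norms strictness comes from strict convexity of the ball; for different norms it
    -- comes from strict convexity of t ↦ t^p.
    by_cases hn : ‖a‖ = ‖b‖
    · have h1 : ‖(2 : ℝ)⁻¹ • (a + b)‖ < ‖a‖ := by
        simpa using (norm_midpoint_lt_iff hn).2 hab
      have h3 := Real.rpow_lt_rpow (norm_nonneg _) h1 hp0
      rw [← hn]; linarith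
    · have h1 : ‖(2 : ℝ)⁻¹ • (a + b)‖ ≤ 2⁻¹ * ‖a‖ + 2⁻¹ * ‖b‖ := by
        rw [norm_smul, ← mul_add]
        simpa using norm_add_le a b
      have h2 := hcv.2 (norm_nonneg a : ‖a‖ ∈ Set.Ici 0) (norm_nonneg b : ‖b‖ ∈ Set.Ici 0) hn
        (by norm_num : (0 : ℝ) < 2⁻¹) (by norm_num : (0 : ℝ) < 2⁻¹) (by norm_num)
      simp only [smul_eq_mul] at h2
      have h3 := Real.rpow_le_rpow (norm_nonneg _) h1 hp0.le
      linarith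
  have cn : ∀ f : F × F → F, Continuous f → Continuous fun z => ‖f z‖ ^ p :=
    fun f hf => hf.norm.rpow_const fun _ => Or.inr hp0.le
  have c1 := cn _ continuous_fst
  have c2 := cn _ continuous_snd
  have c3 := cn (fun z => z.1 - z.2) (by fun_prop)
  have c4 := cn (fun z => (2 : ℝ)⁻¹ • (z.1 + z.2)) (by fun_prop)
  -- Normalized pairs that are far apart form a compact set, on which the continuous positive gap
  -- has a positive minimum δ.
  set K : Set (F × F) := {z | ‖z.1‖ ^ p + ‖z.2‖ ^ p = 1 ∧ ε ≤ ‖z.1 - z.2‖ ^ p} with hK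
  have hKc : IsCompact K := by
    refine Metric.isCompact_of_isClosed_isBounded ?_ ?_
    · exact (isClosed_eq (c1.add c2) continuous_const).inter (isClosed_le continuous_const c3)
    · refine (Metric.isBounded_closedBall (x := (0 : F × F)) (r := 1)).subset fun z hz => ?_
      have h1 : ‖z.1‖ ^ p ≤ 1 := by linarith [hz.1, Real.rpow_nonneg (norm_nonneg z.2) p]
      have h2 : ‖z.2‖ ^ p ≤ 1 := by linarith [hz.1, Real.rpow_nonneg (norm_nonneg z.1) p]
      rw [mem_closedBall_zero_iff]
      exact max_le (le_one h1) (le_one h2)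
  obtain ⟨δ, hδ, hδK⟩ : ∃ δ > 0, ∀ z ∈ K,
      δ ≤ (‖z.1‖ ^ p + ‖z.2‖ ^ p) / 2 - ‖(2 : ℝ)⁻¹ • (z.1 + z.2)‖ ^ p := by
    rcases K.eq_empty_or_nonempty with h | h
    · exact ⟨1, one_pos, by simp [h]⟩
    · obtain ⟨z, hz, hm⟩ := hKc.exists_isMinOn h (((c1.add c2).div_const 2).sub c4).continuousOn
      refine ⟨_, gap_pos z.1 z.2 fun h => ?_, fun w hw => hm hw⟩
      have := hz.2
      rw [h, sub_self, norm_zero, Real.zero_rpow hp0.ne'] at this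
      linarith
  -- On K the difference is at most 2^p and the gap at least δ, hence the constant 2^p/δ. Off K the
  -- ε term alone suffices.
  have sphere : ∀ a b : F, ‖a‖ ^ p + ‖b‖ ^ p = 1 → ‖a - b‖ ^ p ≤ ε * (‖a‖ ^ p + ‖b‖ ^ p) +
      (2 ^ p / δ) * ((‖a‖ ^ p + ‖b‖ ^ p) / 2 - ‖(2 : ℝ)⁻¹ • (a + b)‖ ^ p) := by
    intro a b hab
    have hg := gap_nonneg a b
    by_cases h : ε ≤ ‖a - b‖ ^ p
    · have := hδK (a, b) ⟨hab, h⟩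
      have h1 : ‖a‖ ^ p ≤ 1 := by linarith [Real.rpow_nonneg (norm_nonneg b) p]
      have h2 : ‖b‖ ^ p ≤ 1 := by linarith [Real.rpow_nonneg (norm_nonneg a) p]
      have h1' := le_one h1
      have h2' := le_one h2
      have h3 : ‖a - b‖ ^ p ≤ 2 ^ p :=
        Real.rpow_le_rpow (norm_nonneg _) ((norm_sub_le _ _).trans (by linarith)) hp0.le
      have h4 : 2 ^ p / δ * δ ≤ 2 ^ p / δ *
          ((‖a‖ ^ p + ‖b‖ ^ p) / 2 - ‖(2 : ℝ)⁻¹ • (a + b)‖ ^ p) := by gcongr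
      rw [div_mul_cancel₀ _ hδ.ne'] at h4
      rw [hab] at h4 ⊢
      linarith
    · have : 0 ≤ 2 ^ p / δ * ((‖a‖ ^ p + ‖b‖ ^ p) / 2 - ‖(2 : ℝ)⁻¹ • (a + b)‖ ^ p) := by positivity
      rw [hab] at this ⊢
      linarith
  refine ⟨2 ^ p / δ, by positivity, fun a b => ?_⟩
  set s := ‖a‖ ^ p + ‖b‖ ^ p with hs
  have hs0 : 0 ≤ s := by positivity
  rcases hs0.eq_or_lt with h0 | h0
  · have ha : ‖a‖ ^ p = 0 := by linarith [Real.rpow_nonneg (norm_nonneg a) p, Real.rpow_nonneg (norm_nonneg b) p]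
    have hb : ‖b‖ ^ p = 0 := by linarith [Real.rpow_nonneg (norm_nonneg a) p, Real.rpow_nonneg (norm_nonneg b) p]
    rw [Real.rpow_eq_zero (norm_nonneg _) hp0.ne', norm_eq_zero] at ha hb
    simp [ha, hb, ← h0, hp0.ne']
  -- Every term is p-homogeneous, so scaling by s^(-1/p) reduces to the normalized case.
  set r := s ^ (-1 / p) with hr
  have hr0 : 0 < r := Real.rpow_pos_of_pos h0 _
  have hrp : r ^ p = s⁻¹ := by
    rw [hr, ← Real.rpow_mul h0.le, div_mul_cancel₀ _ hp0.ne', Real.rpow_neg_one]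
  have sc : ∀ v : F, ‖r • v‖ ^ p = s⁻¹ * ‖v‖ ^ p := fun v => by
    rw [norm_smul, Real.mul_rpow (norm_nonneg _) (norm_nonneg _), Real.norm_of_nonneg hr0.le, hrp]
  have := sphere (r • a) (r • b) (by rw [sc, sc, ← mul_add, ← hs, inv_mul_cancel₀ h0.ne'])
  rw [← smul_sub, ← smul_add, smul_comm, sc, sc, sc, sc, ← mul_add, ← hs, mul_div_assoc,
    ← mul_sub, mul_left_comm ε, mul_left_comm _ s⁻¹, ← mul_add] at this
  exact le_of_mul_le_mul_left this (inv_pos.2 h0)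

end

/-! ### The direct method and the Euler–Lagrange equation in L^p. -/

section

/-- A minimizing sequence is Cauchy: the functional at a midpoint is at least the infimum, so the
convexity gap is controlled by the excess over the infimum, and `huc` turns a small gap into a small
distance. The inequality `hPoinc` transfers this to the first component. The minimizer is thus a
strong limit. -/
theorem exists_forall_rpow_sub_le {X Z : Type*} [NormedAddCommGroup X] [NormedSpace ℝ X]
    [CompleteSpace X] [NormedAddCommGroup Z] [NormedSpace ℝ Z] [CompleteSpace Z] {p : ℝ}
    (hp : 1 < p)
    (huc : ∀ ε > 0, ∃ C : ℝ, 0 ≤ C ∧ ∀ a b : Z, ‖a - b‖ ^ p ≤ ε * (‖a‖ ^ p + ‖b‖ ^ p) +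
      C * ((‖a‖ ^ p + ‖b‖ ^ p) / 2 - ‖(2 : ℝ)⁻¹ • (a + b)‖ ^ p))
    {W : Submodule ℝ (X × Z)} (hW : IsClosed (W : Set (X × Z))) {C : ℝ} (hC : 0 ≤ C)
    (hPoinc : ∀ w ∈ W, ‖w.1‖ ≤ C * ‖w.2‖) (ℓ : X →L[ℝ] ℝ) :
    ∃ w ∈ W, ∀ v ∈ W, ‖w.2‖ ^ p / p - ℓ w.1 ≤ ‖v.2‖ ^ p / p - ℓ v.1 := by
  have hp0 : 0 < p := by linarith
  set J : X × Z → ℝ := fun w => ‖w.2‖ ^ p / p - ℓ w.1 with hJ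
  have hJc : Continuous J := by
    have : Continuous fun w : X × Z => ‖w.2‖ ^ p :=
      continuous_snd.norm.rpow_const fun _ => Or.inr hp0.le
    fun_prop
  set K : ℝ := ‖ℓ‖ * C with hK
  have hK0 : 0 ≤ K := by positivity
  have hℓ : ∀ w ∈ W, ℓ w.1 ≤ K * ‖w.2‖ := fun w hw => by
    refine (le_abs_self _).trans ((ℓ.le_opNorm w.1).trans ?_)
    rw [hK, mul_assoc]
    gcongr
    exact hPoinc w hw
  -- Beyond this threshold K t ≤ t^p/(2p), so the linear term absorbs at most half of t^p/p.
  set t₀ : ℝ := (2 * p * K) ^ (p - 1)⁻¹ with ht₀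
  have ht₀0 : 0 ≤ t₀ := by positivity
  have hcoer : ∀ w ∈ W, ‖w.2‖ ≤ t₀ ∨ ‖w.2‖ ^ p ≤ 2 * p * J w := fun w hw => by
    rcases le_total ‖w.2‖ t₀ with h | h
    · exact Or.inl h
    · right
      have h1 : 2 * p * K ≤ ‖w.2‖ ^ (p - 1) := by
        have := Real.rpow_le_rpow ht₀0 h (by linarith : 0 ≤ p - 1)
        rwa [ht₀, ← Real.rpow_mul (by positivity), inv_mul_cancel₀ (by linarith),
          Real.rpow_one] at this
      have h2 : 2 * p * K * ‖w.2‖ ≤ ‖w.2‖ ^ p := by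
        calc 2 * p * K * ‖w.2‖ ≤ ‖w.2‖ ^ (p - 1) * ‖w.2‖ := by gcongr
          _ = ‖w.2‖ ^ p := by
            rw [← Real.rpow_add_one' (norm_nonneg _) (by linarith), sub_add_cancel]
      have h3 := hℓ w hw
      have h4 : 2 * p * J w = 2 * ‖w.2‖ ^ p - 2 * p * ℓ w.1 := by
        simp only [hJ]; field_simp
      have h5 : 2 * p * ℓ w.1 ≤ 2 * p * (K * ‖w.2‖) := by gcongr
      linarith
  have hbdd : BddBelow (J '' W) := by
    refine ⟨-(K * t₀), ?_⟩
    rintro _ ⟨w, hw, rfl⟩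
    rcases hcoer w hw with h | h
    · have h1 : ℓ w.1 ≤ K * t₀ := (hℓ w hw).trans (by gcongr)
      have h2 : 0 ≤ ‖w.2‖ ^ p / p := by positivity
      simp only [hJ]; linarith
    · have h1 : 0 ≤ 2 * p * J w := (by positivity : 0 ≤ ‖w.2‖ ^ p).trans h
      have h2 : 0 ≤ J w := by
        by_contra! h'
        exact absurd h1 (not_le.2 (mul_neg_of_pos_of_neg (by positivity) h'))
      have : 0 ≤ K * t₀ := by positivity
      linarith
  set m := sInf (J '' W) with hm
  have hmle : ∀ w ∈ W, m ≤ J w := fun w hw => csInf_le hbdd ⟨w, hw, rfl⟩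
  have hne : (J '' W).Nonempty := ⟨_, 0, W.zero_mem, rfl⟩
  have hseq : ∀ n : ℕ, ∃ w ∈ W, J w < m + 1 / ((n : ℝ) + 1) := fun n => by
    obtain ⟨_, ⟨w, hw, rfl⟩, h⟩ := Real.lt_sInf_add_pos hne (Nat.one_div_pos_of_nat (α := ℝ) (n := n))
    exact ⟨w, hw, h⟩
  choose w hwW hwJ using hseq
  set B : ℝ := t₀ ^ p + 2 * p * (|m| + 1) with hB
  have hB0 : 0 ≤ B := by positivity
  have hwB : ∀ n, ‖(w n).2‖ ^ p ≤ B := fun n => by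
    rcases hcoer (w n) (hwW n) with h | h
    · have := Real.rpow_le_rpow (norm_nonneg _) h hp0.le
      have h2 : 0 ≤ 2 * p * (|m| + 1) := by positivity
      linarith
    · refine h.trans ?_
      have h1 : J (w n) ≤ |m| + 1 := by
        have h1 := hwJ n
        have h2 : 1 / ((n : ℝ) + 1) ≤ 1 := by
          rw [div_le_one (by positivity)]
          have : (0 : ℝ) ≤ n := by positivity
          linarith
        linarith [le_abs_self m]
      have h2 : 2 * p * J (w n) ≤ 2 * p * (|m| + 1) := by gcongr
      have h3 : 0 ≤ t₀ ^ p := by positivity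
      linarith
  -- The linear term at the midpoint is the average of its values, so it cancels and only the gap of
  -- the norms remains.
  have hgap : ∀ N n k : ℕ, N ≤ n → N ≤ k → (‖(w n).2‖ ^ p + ‖(w k).2‖ ^ p) / 2 -
      ‖(2 : ℝ)⁻¹ • ((w n).2 + (w k).2)‖ ^ p ≤ p * (1 / ((N : ℝ) + 1)) := by
    intro N n k hn hk
    have h1 := hmle ((2 : ℝ)⁻¹ • (w n + w k)) (W.smul_mem _ (W.add_mem (hwW n) (hwW k)))
    have hi : ∀ n, N ≤ n → J (w n) ≤ m + 1 / ((N : ℝ) + 1) := fun n hn => by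
      refine (hwJ n).le.trans ?_
      gcongr
    have h2 := hi n hn
    have h3 := hi k hk
    simp only [hJ, Prod.smul_snd, Prod.snd_add, Prod.smul_fst, Prod.fst_add, map_smul, map_add,
      smul_eq_mul] at h1 h2 h3
    have h4 : ((‖(w n).2‖ ^ p + ‖(w k).2‖ ^ p) / 2 -
      ‖(2 : ℝ)⁻¹ • ((w n).2 + (w k).2)‖ ^ p) / p ≤ 1 / ((N : ℝ) + 1) := by
      rw [sub_div, div_right_comm, add_div]
      linarith
    rwa [div_le_iff₀' hp0] at h4
  have hc2 : CauchySeq fun n => (w n).2 := by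
    refine Metric.cauchySeq_iff.2 fun η hη => ?_
    have hηp : 0 < η ^ p := Real.rpow_pos_of_pos hη p
    -- Each of the two contributions is arranged to be at most η^p/2. The shifts B + 1 and C' + 1
    -- avoid division by zero.
    obtain ⟨C', hC', hU⟩ := huc (η ^ p / (4 * (B + 1))) (by positivity)
    obtain ⟨N, hN⟩ := exists_nat_one_div_lt (K := ℝ) (ε := η ^ p / (2 * (C' + 1) * p))
      (by positivity)
    refine ⟨N, fun n hn k hk => ?_⟩
    rw [dist_eq_norm]
    have h1 := hU (w n).2 (w k).2
    have h2 : η ^ p / (4 * (B + 1)) * (‖(w n).2‖ ^ p + ‖(w k).2‖ ^ p) ≤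
        η ^ p / (4 * (B + 1)) * (2 * (B + 1)) := by
      gcongr
      linarith [hwB n, hwB k]
    have h3 : C' * ((‖(w n).2‖ ^ p + ‖(w k).2‖ ^ p) / 2 -
        ‖(2 : ℝ)⁻¹ • ((w n).2 + (w k).2)‖ ^ p) ≤ C' * (p * (1 / ((N : ℝ) + 1))) := by
      gcongr
      exact hgap N n k hn hk
    have h4 : C' * (p * (1 / ((N : ℝ) + 1))) ≤ (C' + 1) * (p * (1 / ((N : ℝ) + 1))) := by
      gcongr
      linarith
    have h5 : (C' + 1) * (p * (1 / ((N : ℝ) + 1))) < (C' + 1) * (p * (η ^ p / (2 * (C' + 1) * p))) := by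
      gcongr
    have e1 : η ^ p / (4 * (B + 1)) * (2 * (B + 1)) = η ^ p / 2 := by field_simp; norm_num
    have e2 : (C' + 1) * (p * (η ^ p / (2 * (C' + 1) * p))) = η ^ p / 2 := by field_simp
    exact (Real.rpow_lt_rpow_iff (norm_nonneg _) hη.le hp0).1 (by linarith)
  have hc1 : CauchySeq fun n => (w n).1 := by
    refine Metric.cauchySeq_iff.2 fun η hη => ?_
    obtain ⟨N, hN⟩ := Metric.cauchySeq_iff.1 hc2 (η / (C + 1)) (by positivity)
    refine ⟨N, fun n hn k hk => ?_⟩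
    have h1 := hN n hn k hk
    have h2 := hPoinc _ (W.sub_mem (hwW n) (hwW k))
    rw [dist_eq_norm] at h1 ⊢
    rw [lt_div_iff₀ (by positivity)] at h1
    simp only [Prod.fst_sub, Prod.snd_sub] at h2
    nlinarith [norm_nonneg ((w n).2 - (w k).2)]
  obtain ⟨x, hx⟩ := cauchySeq_tendsto_of_complete hc1
  obtain ⟨z, hz⟩ := cauchySeq_tendsto_of_complete hc2
  have hlim : Tendsto w atTop (𝓝 (x, z)) := hx.prodMk_nhds hz
  refine ⟨(x, z), hW.mem_of_tendsto hlim (.of_forall hwW), fun v hv => ?_⟩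
  have h1 : Tendsto (fun n => J (w n)) atTop (𝓝 (J (x, z))) := (hJc.tendsto _).comp hlim
  have h2 : Tendsto (fun n : ℕ => m + 1 / ((n : ℝ) + 1)) atTop (𝓝 (m + 0)) :=
    tendsto_const_nhds.add tendsto_one_div_add_atTop_nhds_zero_nat
  have h3 := le_of_tendsto_of_tendsto h1 h2 (.of_forall fun n => (hwJ n).le)
  rw [add_zero] at h3
  exact h3.trans (hmle v hv)

section Lp

variable {α F : Type*} [MeasurableSpace α] {μ : Measure α} [NormedAddCommGroup F] {p : ℝ}

theorem integrable_norm_rpow_of_memLp (hp : 0 < p) {f : α → F}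
    (hf : MemLp f (ENNReal.ofReal p) μ) : Integrable (fun x => ‖f x‖ ^ p) μ := by
  have := hf.integrable_norm_rpow (by simpa using hp) ENNReal.ofReal_ne_top
  rwa [ENNReal.toReal_ofReal hp.le] at this

theorem norm_toLp_rpow (hp : 0 < p) {f : α → F} (hf : MemLp f (ENNReal.ofReal p) μ) :
    ‖hf.toLp f‖ ^ p = ∫ x, ‖f x‖ ^ p ∂μ := by
  have h0 : 0 ≤ ∫ x, ‖f x‖ ^ p ∂μ := integral_nonneg fun x => by positivity
  rw [Lp.norm_toLp, hf.eLpNorm_eq_integral_rpow_norm (by simpa using hp) ENNReal.ofReal_ne_top,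
    ENNReal.toReal_ofReal hp.le, ENNReal.toReal_ofReal (by positivity), ← Real.rpow_mul h0,
    inv_mul_cancel₀ hp.ne', Real.rpow_one]

theorem Lp_norm_rpow (hp : 0 < p) (f : Lp F (ENNReal.ofReal p) μ) :
    ‖f‖ ^ p = ∫ x, ‖f x‖ ^ p ∂μ := by
  conv_lhs => rw [← Lp.toLp_coeFn f (Lp.memLp f)]
  exact norm_toLp_rpow hp _

/-- The pointwise inequality is linear in p-th powers of norms, so it integrates with the same
constant. -/
theorem Lp_exists_norm_sub_rpow_le [InnerProductSpace ℝ F] [FiniteDimensional ℝ F] (hp : 1 < p)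
    [Fact (1 ≤ ENNReal.ofReal p)] {ε : ℝ} (hε : 0 < ε) :
    ∃ C : ℝ, 0 ≤ C ∧ ∀ f g : Lp F (ENNReal.ofReal p) μ,
      ‖f - g‖ ^ p ≤ ε * (‖f‖ ^ p + ‖g‖ ^ p) +
        C * ((‖f‖ ^ p + ‖g‖ ^ p) / 2 - ‖(2 : ℝ)⁻¹ • (f + g)‖ ^ p) := by
  have hp0 : 0 < p := by linarith
  obtain ⟨C, hC, h⟩ := exists_norm_sub_rpow_le (F := F) hp hε
  refine ⟨C, hC, fun f g => ?_⟩
  have i : ∀ f : Lp F (ENNReal.ofReal p) μ, Integrable (fun x => ‖f x‖ ^ p) μ :=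
    fun f => integrable_norm_rpow_of_memLp hp0 (Lp.memLp f)
  simp only [Lp_norm_rpow hp0]
  have iS : Integrable (fun x => ‖f x‖ ^ p + ‖g x‖ ^ p) μ := (i f).add (i g)
  have iG : Integrable (fun x => (‖f x‖ ^ p + ‖g x‖ ^ p) / 2 -
      ‖((2 : ℝ)⁻¹ • (f + g) : Lp F (ENNReal.ofReal p) μ) x‖ ^ p) μ := (iS.div_const 2).sub (i _)
  rw [← integral_add (i f) (i g), ← integral_div, ← integral_sub (iS.div_const 2) (i _),
    ← integral_const_mul, ← integral_const_mul, ← integral_add (iS.const_mul _) (iG.const_mul _)]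
  refine integral_mono_ae (i _) ((iS.const_mul _).add (iG.const_mul _)) ?_
  filter_upwards [Lp.coeFn_sub f g, Lp.coeFn_smul (2 : ℝ)⁻¹ (f + g), Lp.coeFn_add f g] with x h1 h2 h3
  simp only [Pi.add_apply, h1, h2, h3, Pi.smul_apply, Pi.sub_apply]
  exact h _ _

/-- Differentiation under the integral: for |t| < 1 the derivative is dominated by p(‖G‖ + ‖H‖)^p.
-/
theorem hasDerivAt_integral_norm_add_smul_rpow [InnerProductSpace ℝ F] (hp : 1 < p) {G H : α → F}
    (hG : MemLp G (ENNReal.ofReal p) μ) (hH : MemLp H (ENNReal.ofReal p) μ) :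
    HasDerivAt (fun t : ℝ => ∫ x, ‖G x + t • H x‖ ^ p ∂μ)
      (∫ x, p * (‖G x‖ ^ (p - 2) * inner ℝ (G x) (H x)) ∂μ) 0 := by
  have hp0 : 0 < p := by linarith
  have hd : ∀ x t, HasDerivAt (fun t : ℝ => ‖G x + t • H x‖ ^ p)
      (p * (‖G x + t • H x‖ ^ (p - 2) * inner ℝ (G x + t • H x) (H x))) t := fun x t => by
    have h1 : HasDerivAt (fun t : ℝ => G x + t • H x) (H x) t := by
      simpa using ((hasDerivAt_id t).smul_const (H x)).const_add (G x)
    refine ((hasFDerivAt_norm_rpow _ hp).comp_hasDerivAt t h1).congr_deriv ?_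
    simp [mul_assoc, inner_add_left, real_inner_smul_left, mul_add]
  have hm : ∀ t : ℝ, MemLp (fun x => G x + t • H x) (ENNReal.ofReal p) μ :=
    fun t => hG.add (hH.const_smul t)
  have hb : Integrable (fun x => p * (‖G x‖ + ‖H x‖) ^ p) μ := by
    have := integrable_norm_rpow_of_memLp hp0 (hG.norm.add hH.norm)
    refine (this.congr (.of_forall fun x => ?_)).const_mul p
    simp only [Pi.add_apply]
    rw [Real.norm_of_nonneg (by positivity)]
  have key := hasDerivAt_integral_of_dominated_loc_of_deriv_le (μ := μ) (x₀ := (0 : ℝ))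
    (F := fun t x => ‖G x + t • H x‖ ^ p)
    (F' := fun t x => p * (‖G x + t • H x‖ ^ (p - 2) * inner ℝ (G x + t • H x) (H x)))
    (s := Metric.ball 0 1) (bound := fun x => p * (‖G x‖ + ‖H x‖) ^ p)
    (Metric.ball_mem_nhds _ one_pos)
    (.of_forall fun t => (integrable_norm_rpow_of_memLp hp0 (hm t)).1)
    (integrable_norm_rpow_of_memLp hp0 (hm 0)) ?_ ?_ hb (.of_forall fun x t _ => hd x t)
  · simpa using key.2
  · refine AEStronglyMeasurable.const_mul (AEStronglyMeasurable.mul ?_ ((hm 0).1.inner hH.1)) _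
    exact ((hm 0).1.norm.aemeasurable.pow_const _).aestronglyMeasurable
  · refine .of_forall fun x t ht => ?_
    rw [norm_mul, Real.norm_of_nonneg hp0.le, norm_mul]
    gcongr
    have ht1 : |t| ≤ 1 := by simpa using (mem_ball_zero_iff.1 ht).le
    have hn : ‖G x + t • H x‖ ≤ ‖G x‖ + ‖H x‖ := by
      refine (norm_add_le _ _).trans ?_
      rw [norm_smul]
      gcongr
      exact mul_le_of_le_one_left (norm_nonneg _) ht1
    set a := G x + t • H x
    -- At a = 0 the inner product vanishes, so the value assigned to ‖0‖^(p-2) is immaterial.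
    rcases eq_or_ne a 0 with h0 | h0
    · simp only [h0, inner_zero_left, norm_zero, mul_zero]
      positivity
    · have ha : 0 < ‖a‖ := norm_pos_iff.2 h0
      calc ‖‖a‖ ^ (p - 2)‖ * ‖inner ℝ a (H x)‖ ≤ ‖a‖ ^ (p - 2) * (‖a‖ * ‖H x‖) := by
            rw [Real.norm_of_nonneg (by positivity)]
            gcongr
            exact norm_inner_le_norm _ _
        _ = ‖a‖ ^ (p - 1) * ‖H x‖ := by
            rw [← mul_assoc, ← Real.rpow_add_one ha.ne']; ring_nf
        _ ≤ (‖G x‖ + ‖H x‖) ^ (p - 1) * (‖G x‖ + ‖H x‖) := by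
            gcongr
            linarith [norm_nonneg (G x)]
        _ = (‖G x‖ + ‖H x‖) ^ p := by
            rw [← Real.rpow_add_one' (by positivity) (by linarith), sub_add_cancel]

/-- Vanishing of the first variation at t = 0, where the energy along the line G + tH is minimal. -/
theorem integral_eq_of_forall_rpow_sub_le [InnerProductSpace ℝ F] (hp : 1 < p) {G H : α → F}
    (hG : MemLp G (ENNReal.ofReal p) μ) (hH : MemLp H (ENNReal.ofReal p) μ) {a b : ℝ}
    (h : ∀ t : ℝ, (∫ x, ‖G x‖ ^ p ∂μ) / p - a ≤
      (∫ x, ‖G x + t • H x‖ ^ p ∂μ) / p - (a + t * b)) :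
    ∫ x, ‖G x‖ ^ (p - 2) * inner ℝ (G x) (H x) ∂μ = b := by
  have hder : HasDerivAt (fun t : ℝ => (∫ x, ‖G x + t • H x‖ ^ p ∂μ) / p - (a + t * b))
      ((∫ x, p * (‖G x‖ ^ (p - 2) * inner ℝ (G x) (H x)) ∂μ) / p - b) 0 := by
    refine ((hasDerivAt_integral_norm_add_smul_rpow hp hG hH).div_const p).sub ?_
    simpa using ((hasDerivAt_id (0 : ℝ)).mul_const b).const_add a
  have hloc : IsLocalMin (fun t : ℝ => (∫ x, ‖G x + t • H x‖ ^ p ∂μ) / p - (a + t * b)) 0 :=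
    .of_forall fun t => by simpa using h t
  have hz := hloc.hasDerivAt_eq_zero hder
  rw [integral_const_mul, mul_div_cancel_left₀ _ (by linarith)] at hz
  linarith

end Lp

end

/-! ### Existence of the p-torsion function. -/

section

variable {D : ℕ} {p : ℝ} {Ω : Set (E D)}

theorem IsTestFunction.toLp_gradient_add {φ ψ : E D → ℝ} (hφ : IsTestFunction Ω φ)
    (hψ : IsTestFunction Ω ψ) (r : ENNReal) :
    (hφ.memLp_gradient r).toLp (gradient φ) + (hψ.memLp_gradient r).toLp (gradient ψ) =
      ((hφ.add hψ).memLp_gradient r).toLp (gradient (φ + ψ)) := by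
  rw [← MemLp.toLp_add]
  exact MemLp.toLp_congr _ _ (.of_eq (hφ.gradient_add hψ).symm)

theorem IsTestFunction.toLp_gradient_smul {φ : E D → ℝ} (hφ : IsTestFunction Ω φ) (c : ℝ)
    (r : ENNReal) : c • (hφ.memLp_gradient r).toLp (gradient φ) =
      ((hφ.smul c).memLp_gradient r).toLp (gradient (c • φ)) := by
  rw [← MemLp.toLp_const_smul]
  exact MemLp.toLp_congr _ _ (.of_eq (hφ.gradient_smul c).symm)

/-- The pairs `(φ, ∇φ)`, `φ ∈ C_c^∞(Ω)`, as elements of `L^p × L^p`. -/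
def testPairs (p : ℝ) (Ω : Set (E D)) [Fact (1 ≤ ENNReal.ofReal p)] :
    Submodule ℝ (Lp ℝ (ENNReal.ofReal p) (volume.restrict Ω) ×
      Lp (E D) (ENNReal.ofReal p) (volume.restrict Ω)) where
  carrier := {w | ∃ (φ : E D → ℝ) (h : IsTestFunction Ω φ),
    w = ((h.memLp _).toLp φ, (h.memLp_gradient _).toLp (gradient φ))}
  zero_mem' := by
    refine ⟨0, isTestFunction_zero, ?_⟩
    rw [← Prod.mk_zero_zero, Prod.mk.injEq]
    refine ⟨(MemLp.toLp_zero _).symm, ?_⟩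
    have := (isTestFunction_zero (Ω := Ω)).toLp_gradient_smul 0 (ENNReal.ofReal p)
    rw [zero_smul] at this
    refine this.trans (MemLp.toLp_congr _ _ (.of_eq ?_))
    rw [zero_smul]
  add_mem' := by
    rintro _ _ ⟨φ, hφ, rfl⟩ ⟨ψ, hψ, rfl⟩
    refine ⟨φ + ψ, hφ.add hψ, ?_⟩
    rw [Prod.mk_add_mk, hφ.toLp_gradient_add hψ, ← MemLp.toLp_add]
  smul_mem' := by
    rintro c _ ⟨φ, hφ, rfl⟩
    refine ⟨c • φ, hφ.smul c, ?_⟩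
    rw [Prod.smul_mk, hφ.toLp_gradient_smul, ← MemLp.toLp_const_smul]

theorem MemWZero.mem_closure_testPairs [Fact (1 ≤ ENNReal.ofReal p)] {u : E D → ℝ} {G : E D → E D}
    (h : MemWZero p Ω u G) :
    (h.1.1.toLp u, h.1.2.1.toLp G) ∈ (testPairs p Ω).topologicalClosure := by
  obtain ⟨φ, hφ, h1, h2⟩ := h.2
  rw [← SetLike.mem_coe, Submodule.topologicalClosure_coe]
  refine mem_closure_of_tendsto (b := atTop) (f := fun n => (((hφ n).memLp _).toLp (φ n),
    ((hφ n).memLp_gradient _).toLp (gradient (φ n)))) (Tendsto.prodMk_nhds ?_ ?_)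
    (.of_forall fun n => ⟨φ n, hφ n, rfl⟩)
  · exact (Lp.tendsto_Lp_iff_tendsto_eLpNorm'' _ _ _ _).2 h1
  · exact (Lp.tendsto_Lp_iff_tendsto_eLpNorm'' _ _ _ _).2 h2

/-- With `MemWZero.mem_closure_testPairs` this identifies W_0^{1,p}(Ω) with a closed subspace of L^p
× L^p, where the abstract minimization applies. -/
theorem memWZero_of_mem_closure_testPairs [IsFiniteMeasure (volume.restrict Ω)]
    [hp : Fact (1 ≤ ENNReal.ofReal p)]
    {w : Lp ℝ (ENNReal.ofReal p) (volume.restrict Ω) ×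
      Lp (E D) (ENNReal.ofReal p) (volume.restrict Ω)}
    (hw : w ∈ (testPairs p Ω).topologicalClosure) : MemWZero p Ω w.1 w.2 := by
  obtain ⟨s, hs, hlim⟩ := mem_closure_iff_seq_limit.1 hw
  choose φ hφ hsφ using hs
  obtain rfl : s = _ := funext hsφ
  have t1 := (Lp.tendsto_Lp_iff_tendsto_eLpNorm' _ _).1 ((continuous_fst.tendsto _).comp hlim)
  have t2 := (Lp.tendsto_Lp_iff_tendsto_eLpNorm' _ _).1 ((continuous_snd.tendsto _).comp hlim)
  have h1 : Tendsto (fun n => eLpNorm (fun x => φ n x - w.1 x) (ENNReal.ofReal p)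
      (volume.restrict Ω)) atTop (𝓝 0) := by
    refine t1.congr fun n => eLpNorm_congr_ae ?_
    filter_upwards [((hφ n).memLp (ENNReal.ofReal p)).coeFn_toLp] with x hx
    simp [hx]
  have h2 : Tendsto (fun n => eLpNorm (fun x => gradient (φ n) x - w.2 x) (ENNReal.ofReal p)
      (volume.restrict Ω)) atTop (𝓝 0) := by
    refine t2.congr fun n => eLpNorm_congr_ae ?_
    filter_upwards [((hφ n).memLp_gradient (ENNReal.ofReal p)).coeFn_toLp] with x hx
    simp [hx]
  exact ⟨⟨Lp.memLp _, Lp.memLp _, isWeakGradient_of_tendsto hp.out hφ (Lp.memLp _) (Lp.memLp _)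
    h1 h2⟩, φ, hφ, h1, h2⟩

/-- The Poincaré inequality is a closed condition, so it extends from test pairs to their closure.
-/
theorem norm_fst_le_of_mem_closure_testPairs [Fact (1 ≤ ENNReal.ofReal p)] (hp : 1 < p)
    {i : Fin D} {c ρ : ℝ} (hΩ : ∀ x ∈ Ω, |x i - c| ≤ ρ) (hρ : 0 ≤ ρ)
    {w : Lp ℝ (ENNReal.ofReal p) (volume.restrict Ω) ×
      Lp (E D) (ENNReal.ofReal p) (volume.restrict Ω)}
    (hw : w ∈ (testPairs p Ω).topologicalClosure) : ‖w.1‖ ≤ (ρ * p) * ‖w.2‖ := by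
  have hp0 : 0 < p := by linarith
  have hcl : IsClosed {w : Lp ℝ (ENNReal.ofReal p) (volume.restrict Ω) ×
      Lp (E D) (ENNReal.ofReal p) (volume.restrict Ω) | ‖w.1‖ ≤ (ρ * p) * ‖w.2‖} :=
    isClosed_le (by fun_prop) (by fun_prop)
  refine closure_minimal ?_ hcl hw
  rintro _ ⟨φ, hφ, rfl⟩
  refine (Real.rpow_le_rpow_iff (norm_nonneg _) (by positivity) hp0).1 ?_
  rw [Real.mul_rpow (by positivity) (norm_nonneg _), norm_toLp_rpow hp0, norm_toLp_rpow hp0]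
  exact hφ.integral_norm_rpow_le hp hΩ hρ

/-- Integration as a continuous linear functional on `L^p` of a finite measure. -/
theorem exists_integral_clm {α : Type*} [MeasurableSpace α] (μ : Measure α) [IsFiniteMeasure μ]
    (r : ENNReal) [hr : Fact (1 ≤ r)] :
    ∃ ℓ : Lp ℝ r μ →L[ℝ] ℝ, ∀ f, ℓ f = ∫ x, f x ∂μ := by
  have i : ∀ f : Lp ℝ r μ, Integrable f μ := fun f => (Lp.memLp f).integrable hr.out
  let L : Lp ℝ r μ →ₗ[ℝ] ℝ :=
    { toFun := fun f => ∫ x, f x ∂μ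
      map_add' := fun f g => by
        rw [← integral_add (i f) (i g)]
        exact integral_congr_ae (Lp.coeFn_add f g)
      map_smul' := fun c f => by
        rw [RingHom.id_apply, ← integral_smul]
        exact integral_congr_ae (Lp.coeFn_smul c f) }
  refine ⟨⟨L, ?_⟩, fun f => rfl⟩
  refine continuous_iff_seqContinuous.2 fun f g h => ?_
  have := tendsto_integral_smul_of_tendsto_eLpNorm (μ := μ) (f := fun n => f n) (g := g) hr.out
    (fun n => Lp.memLp _) (Lp.memLp _) ((Lp.tendsto_Lp_iff_tendsto_eLpNorm' _ _).1 h)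
    (B := fun _ => ContinuousLinearMap.id ℝ ℝ) (M := 1)
    (.of_forall fun x => by simp)
    (fun f hf => hf)
  exact this

/-- The solution minimizes ‖∇u‖^p/p - ∫ u over W_0^{1,p}(Ω). Existence guarantees that
`torsionFunction` is not its default value 0. -/
theorem exists_isTorsionFunction [IsFiniteMeasure (volume.restrict Ω)] (hp : 1 < p)
    {i : Fin D} {c ρ : ℝ} (hΩ : ∀ x ∈ Ω, |x i - c| ≤ ρ) (hρ : 0 ≤ ρ) :
    ∃ u, IsTorsionFunction p Ω u := by
  have hp0 : 0 < p := by linarith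
  have hF : Fact (1 ≤ ENNReal.ofReal p) := ⟨by simpa using hp.le⟩
  obtain ⟨ℓ, hℓ⟩ := exists_integral_clm (volume.restrict Ω) (ENNReal.ofReal p)
  have huc := fun (ε : ℝ) (hε : ε > 0) =>
    Lp_exists_norm_sub_rpow_le (F := E D) (μ := volume.restrict Ω) hp hε
  have hP := fun w (hw : w ∈ (testPairs p Ω).topologicalClosure) =>
    norm_fst_le_of_mem_closure_testPairs hp hΩ hρ hw
  have hcl := (testPairs p Ω).isClosed_topologicalClosure
  have key := exists_forall_rpow_sub_le (X := Lp ℝ (ENNReal.ofReal p) (volume.restrict Ω))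
    (Z := Lp (E D) (ENNReal.ofReal p) (volume.restrict Ω)) hp huc
    (W := (testPairs p Ω).topologicalClosure) hcl (C := ρ * p) (by positivity) hP ℓ
  obtain ⟨w, hw, hmin⟩ := key
  refine ⟨w.1, w.2, memWZero_of_mem_closure_testPairs hw, fun v H hv => ?_⟩
  have hvm := hv.mem_closure_testPairs
  have hH := hv.1.2.1
  refine integral_eq_of_forall_rpow_sub_le hp (Lp.memLp w.2) hH (a := ℓ w.1) fun t => ?_
  have h := hmin _ (Submodule.add_mem _ hw (Submodule.smul_mem _ t hvm))
  have e1 : ‖w.2 + t • hH.toLp H‖ ^ p = ∫ x in Ω, ‖w.2 x + t • H x‖ ^ p := by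
    rw [Lp_norm_rpow hp0]
    refine integral_congr_ae ?_
    filter_upwards [Lp.coeFn_add w.2 (t • hH.toLp H), Lp.coeFn_smul t (hH.toLp H),
      hH.coeFn_toLp] with x h1 h2 h3
    rw [h1, Pi.add_apply, h2, Pi.smul_apply, h3]
  have e2 : ℓ (hv.1.1.toLp v) = ∫ x in Ω, v x := by
    rw [hℓ]
    exact integral_congr_ae hv.1.1.coeFn_toLp
  rw [Prod.snd_add, Prod.smul_snd, Prod.fst_add, Prod.smul_fst, map_add, map_smul, e1, e2,
    Lp_norm_rpow hp0, smul_eq_mul] at h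
  exact h

/-- Uniqueness is not needed: the estimates below hold for every weak solution, hence for the chosen
one. -/
theorem isTorsionFunction_torsionFunction (h : ∃ u, IsTorsionFunction p Ω u) :
    IsTorsionFunction p Ω (torsionFunction p Ω) := by
  rw [torsionFunction, dif_pos h]
  exact h.choose_spec

end

/-! ### Energy identity and the two Hölder estimates for the rigidity. -/

section

variable {D : ℕ} {p : ℝ} {Ω : Set (E D)}

/-- The solution is itself an admissible test function. -/
theorem integral_eq_integral_norm_rpow_of_weak_solution (hp : 1 < p) {u : E D → ℝ} {G : E D → E D}
    (h : MemWZero p Ω u G) (hE : ∀ (v : E D → ℝ) (H : E D → E D), MemWZero p Ω v H →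
      ∫ x in Ω, ‖G x‖ ^ (p - 2) * inner ℝ (G x) (H x) = ∫ x in Ω, v x) :
    ∫ x in Ω, u x = ∫ x in Ω, ‖G x‖ ^ p := by
  rw [← hE u G h]
  refine integral_congr_ae (.of_forall fun x => ?_)
  dsimp only
  rcases eq_or_ne (G x) 0 with h0 | h0
  · simp [h0, Real.zero_rpow (by linarith : p ≠ 0)]
  · rw [real_inner_self_eq_norm_sq, ← Real.rpow_natCast, ← Real.rpow_add (norm_pos_iff.2 h0)]
    norm_num

/-- Test the equation with φ, apply Hölder to |G|^(p-1) |∇φ|, and replace ∫ |G|^p by ∫ u. Every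
competitor φ thereby bounds the rigidity from below. -/
theorem integral_le_of_weak_solution (hp : 1 < p) {u : E D → ℝ} {G : E D → E D}
    (h : MemWZero p Ω u G) (hE : ∀ (v : E D → ℝ) (H : E D → E D), MemWZero p Ω v H →
      ∫ x in Ω, ‖G x‖ ^ (p - 2) * inner ℝ (G x) (H x) = ∫ x in Ω, v x)
    {φ : E D → ℝ} (hφ : IsTestFunction Ω φ) :
    ∫ x in Ω, φ x ≤ (∫ x in Ω, u x) ^ (1 / p.conjExponent) *
      (∫ x in Ω, ‖gradient φ x‖ ^ p) ^ (1 / p) := by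
  have hpq := Real.HolderConjugate.conjExponent hp
  set q := p.conjExponent with hq
  have := hpq.symm.ennrealOfReal
  have hp0 : 0 < p := by linarith
  have e1 : ∀ x, (‖G x‖ ^ (p - 1)) ^ q = ‖G x‖ ^ p := fun x => by
    rw [← Real.rpow_mul (norm_nonneg _), hpq.sub_one_mul_conj]
  have mG : MemLp (fun x => ‖G x‖ ^ (p - 1)) (ENNReal.ofReal q) (volume.restrict Ω) := by
    have hm : AEStronglyMeasurable (fun x => ‖G x‖ ^ (p - 1)) (volume.restrict Ω) :=
      (h.1.2.1.1.norm.aemeasurable.pow_const _).aestronglyMeasurable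
    rw [← integrable_norm_rpow_iff hm (by simpa using hpq.symm.pos) ENNReal.ofReal_ne_top,
      ENNReal.toReal_ofReal hpq.symm.nonneg]
    refine (integrable_norm_rpow_of_memLp hp0 h.1.2.1).congr (.of_forall fun x => ?_)
    dsimp only
    rw [Real.norm_of_nonneg (by positivity), e1]
  have mφ : MemLp (fun x => ‖gradient φ x‖) (ENNReal.ofReal p) (volume.restrict Ω) :=
    (hφ.memLp_gradient _).norm
  have hH := integral_mul_le_Lp_mul_Lq_of_nonneg hpq.symm
    (.of_forall fun x => by positivity) (.of_forall fun x => by positivity) mG mφ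
  simp only [e1] at hH
  rw [integral_eq_integral_norm_rpow_of_weak_solution hp h hE, ← hE φ _ hφ.memWZero]
  refine le_trans ?_ hH
  refine (le_abs_self _).trans ((Real.norm_eq_abs _).symm.le.trans
    (norm_integral_le_of_norm_le (mG.integrable_mul mφ) (.of_forall fun x => ?_)))
  rcases eq_or_ne (G x) 0 with h0 | h0
  · simp only [h0, inner_zero_left, norm_zero, mul_zero]
    positivity
  · rw [norm_mul, Real.norm_of_nonneg (by positivity)]
    calc ‖G x‖ ^ (p - 2) * ‖inner ℝ (G x) (gradient φ x)‖
        ≤ ‖G x‖ ^ (p - 2) * (‖G x‖ * ‖gradient φ x‖) := by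
          gcongr
          exact norm_inner_le_norm _ _
      _ = ‖G x‖ ^ (p - 1) * ‖gradient φ x‖ := by
          rw [← mul_assoc, ← Real.rpow_add_one (norm_ne_zero_iff.2 h0)]
          ring_nf

/-- Integrating by parts against x_i - c gives ∫ u = -∫ (x_i - c) G_i, to which Hölder and the
energy identity apply. The coordinate lacks compact support, but u is a limit of test functions, so
no boundary term appears. -/
theorem integral_le_integral_coord_rpow_of_weak_solution [IsFiniteMeasure (volume.restrict Ω)]
    (hΩm : MeasurableSet Ω) (hp : 1 < p) {u : E D → ℝ} {G : E D → E D}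
    (h : MemWZero p Ω u G) (hE : ∀ (v : E D → ℝ) (H : E D → E D), MemWZero p Ω v H →
      ∫ x in Ω, ‖G x‖ ^ (p - 2) * inner ℝ (G x) (H x) = ∫ x in Ω, v x)
    {i : Fin D} {c ρ : ℝ} (hΩ : ∀ x ∈ Ω, |x i - c| ≤ ρ) :
    ∫ x in Ω, u x ≤ ∫ x in Ω, |x i - c| ^ p.conjExponent := by
  have hpq := Real.HolderConjugate.conjExponent hp
  set q := p.conjExponent with hq
  have hconj := hpq.symm.ennrealOfReal
  have hp0 : 0 < p := by linarith
  have h1p : 1 ≤ ENNReal.ofReal p := by simpa using hp.le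
  have hT := integral_eq_integral_norm_rpow_of_weak_solution hp h hE
  obtain ⟨φ, hφ, t1, t2⟩ := h.2
  have hae : ∀ᵐ x ∂volume.restrict Ω, |x i - c| ≤ ρ := by
    filter_upwards [ae_restrict_mem hΩm] with x hx using hΩ x hx
  have hid := integral_smul_gradient_of_tendsto h1p hφ h.1.1 h.1.2.1 t1 t2
    (contDiff_coord_sub i c) (M := (max ρ 1).toNNReal) <| by
      filter_upwards [hae] with x hx
      rw [gradient_coord_sub, PiLp.norm_single, norm_one]
      exact ⟨hx.trans ((le_max_left _ _).trans (Real.le_coe_toNNReal _)),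
        (le_max_right _ _).trans (Real.le_coe_toNNReal _)⟩
  have cc : Continuous fun x : E D => x i - c := (contDiff_coord_sub i c (n := 0)).continuous
  have mc : MemLp (fun x : E D => |x i - c|) (ENNReal.ofReal q) (volume.restrict Ω) :=
    MemLp.of_bound cc.abs.aestronglyMeasurable ρ (by filter_upwards [hae] with x hx; simpa using hx)
  have mG := h.1.2.1.norm
  have iG : Integrable (fun x => (x i - c) • G x) (volume.restrict Ω) := by
    refine (mc.integrable_mul mG).mono' (cc.aestronglyMeasurable.smul h.1.2.1.1)
      (.of_forall fun x => ?_)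
    rw [norm_smul, Real.norm_eq_abs]
    rfl
  simp only [gradient_coord_sub] at hid
  have hid2 := congrArg (inner ℝ (EuclideanSpace.single i (1 : ℝ))) hid
  rw [inner_neg_right, ← integral_inner ((h.1.1.integrable h1p).smul_const _),
    ← integral_inner iG] at hid2
  have hid3 : ∫ x in Ω, u x = - ∫ x in Ω, (x i - c) * G x i := by
    simpa [inner_smul_right, EuclideanSpace.inner_single_left] using hid2
  have hle : ∫ x in Ω, u x ≤ ∫ x in Ω, |x i - c| * ‖G x‖ := by
    rw [hid3, ← integral_neg]
    refine (le_abs_self _).trans ((Real.norm_eq_abs _).symm.le.trans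
      (norm_integral_le_of_norm_le (mc.integrable_mul mG) (.of_forall fun x => ?_)))
    rw [norm_neg, norm_mul]
    exact mul_le_mul_of_nonneg_left (PiLp.norm_apply_le _ _) (norm_nonneg _)
  have hH := integral_mul_le_Lp_mul_Lq_of_nonneg hpq.symm
    (.of_forall fun x => by positivity) (.of_forall fun x => by positivity) mc mG
  rw [← hT] at hH
  set T := ∫ x in Ω, u x
  set B := ∫ x in Ω, |x i - c| ^ q
  have hT0 : 0 ≤ T := by rw [hT]; exact integral_nonneg fun x => by positivity
  have hB0 : 0 ≤ B := integral_nonneg fun x => by positivity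
  rcases hT0.eq_or_lt with h0 | h0
  · rwa [← h0]
  have hs : T ^ (1 / q) * T ^ (1 / p) = T := by
    rw [← Real.rpow_add h0, one_div, one_div, add_comm, hpq.inv_add_inv_eq_one, Real.rpow_one]
  have h4 : T ^ (1 / q) ≤ B ^ (1 / q) := by
    refine le_of_mul_le_mul_right ?_ (Real.rpow_pos_of_pos h0 (1 / p))
    rw [hs]
    exact hle.trans hH
  exact (Real.rpow_le_rpow_iff hT0 hB0 (by simpa using hpq.symm.pos)).1 h4

end

/-! ### Smooth substitutes for the minimum and for the positive part. -/

section

/-- The smooth minimum of finitely many functions, with sharpness `m`. -/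
noncomputable def softMin {ι F : Type*} [Fintype ι] (ℓ : ι → F → ℝ) (m : ℝ) (x : F) : ℝ :=
  -Real.log (∑ i, Real.exp (-(m * ℓ i x))) / m

section SoftMin

variable {ι F : Type*} [Fintype ι] {ℓ : ι → F → ℝ} {m : ℝ} {x : F}

/-- A sum of at least two positive terms strictly exceeds each of them. Strictness later keeps
`softMin` below R, away from the singularity of the profile. -/
theorem softMin_lt [Nontrivial ι] (hm : 0 < m) (i : ι) : softMin ℓ m x < ℓ i x := by
  rw [softMin, div_lt_iff₀ hm, neg_lt, mul_comm]
  refine (Real.lt_log_iff_exp_lt ?_).2 ?_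
  · exact Finset.sum_pos (fun i _ => Real.exp_pos _) ⟨i, Finset.mem_univ i⟩
  · obtain ⟨j, hj⟩ := exists_ne i
    exact Finset.single_lt_sum (f := fun i => Real.exp (-(m * ℓ i x))) hj (Finset.mem_univ i) (Finset.mem_univ j) (Real.exp_pos _)
      fun k _ _ => (Real.exp_pos _).le

/-- Each of the N exponentials is at most exp(-md), which costs (log N)/m; this error vanishes as m
grows. -/
theorem le_softMin [Nonempty ι] (hm : 0 < m) {d : ℝ} (h : ∀ i, d ≤ ℓ i x) :
    d - Real.log (Fintype.card ι) / m ≤ softMin ℓ m x := by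
  have hc : (0 : ℝ) < Fintype.card ι := by exact_mod_cast Fintype.card_pos
  have h1 : ∑ i, Real.exp (-(m * ℓ i x)) ≤ Fintype.card ι * Real.exp (-(m * d)) := by
    refine (Finset.sum_le_card_nsmul _ _ (Real.exp (-(m * d))) fun i _ => ?_).trans_eq (by simp)
    exact Real.exp_le_exp.2 (neg_le_neg (mul_le_mul_of_nonneg_left (h i) hm.le))
  have h2 := Real.log_le_log (Finset.sum_pos (fun i _ => Real.exp_pos _) Finset.univ_nonempty) h1
  rw [Real.log_mul hc.ne' (Real.exp_pos _).ne', Real.log_exp] at h2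
  rw [softMin, le_div_iff₀ hm, sub_mul, div_mul_cancel₀ _ hm.ne']
  linarith

/-- Moving from y to x changes each exponential by a factor of at least exp(-m dist x y). This gives
the gradient bound 1, as for a distance function. -/
theorem lipschitzWith_softMin [PseudoMetricSpace F] [Nonempty ι] (hm : 0 < m)
    (h : ∀ i, LipschitzWith 1 (ℓ i)) : LipschitzWith 1 (softMin ℓ m) := by
  refine LipschitzWith.of_le_add fun x y => ?_
  have hpos : ∀ x, 0 < ∑ i, Real.exp (-(m * ℓ i x)) := fun x =>
    Finset.sum_pos (fun i _ => Real.exp_pos _) Finset.univ_nonempty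
  have h1 : Real.exp (-(m * dist x y)) * ∑ i, Real.exp (-(m * ℓ i y)) ≤
      ∑ i, Real.exp (-(m * ℓ i x)) := by
    rw [Finset.mul_sum]
    refine Finset.sum_le_sum fun i _ => ?_
    rw [← Real.exp_add, Real.exp_le_exp]
    have h2 : ℓ i x ≤ ℓ i y + dist x y := by
      have := (h i).dist_le_mul x y
      rw [NNReal.coe_one, one_mul, Real.dist_eq] at this
      linarith [le_abs_self (ℓ i x - ℓ i y)]
    have := mul_le_mul_of_nonneg_left h2 hm.le
    linarith
  have h2 := Real.log_le_log (mul_pos (Real.exp_pos _) (hpos y)) h1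
  rw [Real.log_mul (Real.exp_pos _).ne' (hpos y).ne', Real.log_exp] at h2
  rw [softMin, softMin, div_add' _ _ _ hm.ne', div_le_div_iff_of_pos_right hm]
  linarith

theorem contDiff_softMin [NormedAddCommGroup F] [NormedSpace ℝ F] [Nonempty ι]
    {n : WithTop ℕ∞} (h : ∀ i, ContDiff ℝ n (ℓ i)) : ContDiff ℝ n (softMin ℓ m) := by
  refine ContDiff.div_const (ContDiff.neg (ContDiff.log ?_ fun x => ?_)) m
  · exact ContDiff.sum fun i _ => ((contDiff_const.mul (h i)).neg).exp
  · exact (Finset.sum_pos (fun i _ => Real.exp_pos _) Finset.univ_nonempty).ne'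

end SoftMin

/-- A smooth ramp: `0` on `(-∞, 1]`, with slope between `0` and `1`, and slope `1` on `[2, ∞)`. -/
noncomputable def smoothRamp (s : ℝ) : ℝ := ∫ u in (0 : ℝ)..s, Real.smoothTransition (u - 1)

theorem continuous_smoothTransition_sub_one :
    Continuous fun u : ℝ => Real.smoothTransition (u - 1) :=
  Real.smoothTransition.continuous.comp (continuous_id.sub continuous_const)

theorem hasDerivAt_smoothRamp (s : ℝ) :
    HasDerivAt smoothRamp (Real.smoothTransition (s - 1)) s :=
  continuous_smoothTransition_sub_one.integral_hasStrictDerivAt 0 s |>.hasDerivAt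

theorem contDiff_smoothRamp : ContDiff ℝ ∞ smoothRamp := by
  rw [contDiff_infty_iff_deriv]
  refine ⟨fun s => (hasDerivAt_smoothRamp s).differentiableAt, ?_⟩
  have : deriv smoothRamp = fun s => Real.smoothTransition (s - 1) :=
    funext fun s => (hasDerivAt_smoothRamp s).deriv
  rw [this]
  exact Real.smoothTransition.contDiff.comp (contDiff_id.sub contDiff_const)

theorem smoothRamp_eq_zero {s : ℝ} (hs : s ≤ 1) : smoothRamp s = 0 := by
  rw [smoothRamp, intervalIntegral.integral_congr (g := fun _ => 0), intervalIntegral.integral_zero]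
  intro u hu
  refine Real.smoothTransition.zero_of_nonpos ?_
  have : u ≤ max 0 s := (Set.mem_Icc.1 hu).2
  have : max 0 s ≤ 1 := max_le zero_le_one hs
  linarith

theorem smoothRamp_nonneg (s : ℝ) : 0 ≤ smoothRamp s := by
  rcases le_total s 1 with h | h
  · rw [smoothRamp_eq_zero h]
  · exact intervalIntegral.integral_nonneg (by linarith) fun u _ => Real.smoothTransition.nonneg _

theorem smoothRamp_le {s : ℝ} (hs : 0 ≤ s) : smoothRamp s ≤ s := by
  have := intervalIntegral.integral_mono_on (μ := volume) hs
    (continuous_smoothTransition_sub_one.intervalIntegrable 0 s)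
    (intervalIntegrable_const (c := (1 : ℝ))) fun u _ => Real.smoothTransition.le_one _
  rwa [intervalIntegral.integral_const, smul_eq_mul, mul_one, sub_zero] at this

/-- After rescaling to s ↦ `smoothRamp` (m s)/m, the loss is at most 2/m. -/
theorem sub_two_le_smoothRamp (s : ℝ) : s - 2 ≤ smoothRamp s := by
  rcases le_total s 2 with h | h
  · linarith [smoothRamp_nonneg s]
  · have h1 : smoothRamp s = smoothRamp 2 + ∫ u in (2 : ℝ)..s, Real.smoothTransition (u - 1) :=
      (intervalIntegral.integral_add_adjacent_intervals
        (continuous_smoothTransition_sub_one.intervalIntegrable 0 2)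
        (continuous_smoothTransition_sub_one.intervalIntegrable 2 s)).symm
    have h2 : ∫ u in (2 : ℝ)..s, Real.smoothTransition (u - 1) = ∫ u in (2 : ℝ)..s, (1 : ℝ) := by
      refine intervalIntegral.integral_congr fun u hu => ?_
      rw [Set.uIcc_of_le h] at hu
      exact Real.smoothTransition.one_of_one_le (by linarith [hu.1])
    rw [h1, h2, intervalIntegral.integral_const, smul_eq_mul, mul_one]
    linarith [smoothRamp_nonneg 2]

end

/-! ### The competitor built from the distance to the boundary. -/

section

/-- The signed distances to the four sides of the rectangle `(0,L) × (0,2R)`. -/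
def sideDist (R L : ℝ) : Fin 4 → E 2 → ℝ :=
  ![fun x => x 0, fun x => L - x 0, fun x => x 1, fun x => 2 * R - x 1]

/-- The distance of a point of the rectangle to its boundary. -/
noncomputable def depth (R L : ℝ) (x : E 2) : ℝ :=
  min (min (x 0) (L - x 0)) (min (x 1) (2 * R - x 1))

variable {R L : ℝ}

theorem lipschitzWith_coord {D : ℕ} (i : Fin D) : LipschitzWith 1 fun x : E D => x i :=
  LipschitzWith.of_dist_le_mul fun x y => by
    rw [NNReal.coe_one, one_mul, dist_eq_norm, dist_eq_norm]
    exact PiLp.norm_apply_le (x - y) i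

theorem lipschitzWith_const_sub_coord {D : ℕ} (i : Fin D) (c : ℝ) :
    LipschitzWith 1 fun x : E D => c - x i :=
  LipschitzWith.of_dist_le_mul fun x y => by
    rw [dist_sub_left]
    exact (lipschitzWith_coord i).dist_le_mul x y

theorem contDiff_coord {D : ℕ} (i : Fin D) {n : WithTop ℕ∞} :
    ContDiff ℝ n fun x : E D => x i :=
  (EuclideanSpace.proj (𝕜 := ℝ) i : E D →L[ℝ] ℝ).contDiff

theorem lipschitzWith_sideDist (i : Fin 4) : LipschitzWith 1 (sideDist R L i) := by
  fin_cases i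
  · exact lipschitzWith_coord 0
  · exact lipschitzWith_const_sub_coord 0 L
  · exact lipschitzWith_coord 1
  · exact lipschitzWith_const_sub_coord 1 (2 * R)

theorem contDiff_sideDist (i : Fin 4) {n : WithTop ℕ∞} : ContDiff ℝ n (sideDist R L i) := by
  fin_cases i
  · exact contDiff_coord 0
  · exact contDiff_const.sub (contDiff_coord 0)
  · exact contDiff_coord 1
  · exact contDiff_const.sub (contDiff_coord 1)

theorem depth_le_sideDist (x : E 2) (i : Fin 4) : depth R L x ≤ sideDist R L i x := by
  fin_cases i <;> simp [depth, sideDist]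

theorem depth_pos_iff {x : E 2} : 0 < depth R L x ↔ x ∈ rectangle R L := by
  simp [depth, rectangle, and_assoc]

theorem depth_le (x : E 2) : depth R L x ≤ R := by
  have h1 : depth R L x ≤ x 1 := (min_le_right _ _).trans (min_le_left _ _)
  have h2 : depth R L x ≤ 2 * R - x 1 := (min_le_right _ _).trans (min_le_right _ _)
  linarith

theorem continuous_depth : Continuous (depth R L) := by
  unfold depth
  fun_prop

theorem isOpen_rectangle : IsOpen (rectangle R L) := by
  have : rectangle R L = {x | 0 < depth R L x} := Set.ext fun x => depth_pos_iff.symm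
  rw [this]
  exact isOpen_lt continuous_const continuous_depth

theorem isBounded_rectangle : Bornology.IsBounded (rectangle R L) := by
  refine (Metric.isBounded_closedBall (x := (0 : E 2)) (r := L + 2 * R)).subset fun x hx => ?_
  obtain ⟨⟨h1, h2⟩, h3, h4⟩ := hx
  rw [mem_closedBall_zero_iff, EuclideanSpace.norm_eq, Fin.sum_univ_two]
  refine Real.sqrt_le_iff.2 ⟨by linarith, ?_⟩
  rw [Real.norm_of_nonneg h1.le, Real.norm_of_nonneg h3.le]
  nlinarith

instance : IsFiniteMeasure (volume.restrict (rectangle R L)) :=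
  ⟨by simpa using isBounded_rectangle.measure_lt_top⟩

theorem softMin_sideDist_lt {m : ℝ} (hm : 0 < m) (x : E 2) :
    softMin (sideDist R L) m x < depth R L x := by
  refine lt_min (lt_min ?_ ?_) (lt_min ?_ ?_)
  · exact softMin_lt hm 0
  · exact softMin_lt hm 1
  · exact softMin_lt hm 2
  · exact softMin_lt hm 3

theorem tendsto_softMin_sideDist (x : E 2) :
    Tendsto (fun n : ℕ => softMin (sideDist R L) ((n : ℝ) + 1) x) atTop (𝓝 (depth R L x)) := by
  have h : Tendsto (fun n : ℕ => depth R L x - Real.log (Fintype.card (Fin 4)) *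
      (1 / ((n : ℝ) + 1))) atTop (𝓝 (depth R L x - Real.log (Fintype.card (Fin 4)) * 0)) :=
    tendsto_const_nhds.sub (tendsto_one_div_add_atTop_nhds_zero_nat.const_mul _)
  rw [mul_zero, sub_zero] at h
  refine tendsto_of_tendsto_of_tendsto_of_le_of_le h tendsto_const_nhds (fun n => ?_) fun n =>
    (softMin_sideDist_lt (by positivity) x).le
  have := le_softMin (ℓ := sideDist R L) (x := x) (by positivity : (0 : ℝ) < n + 1)
    (depth_le_sideDist x)
  rwa [div_eq_mul_one_div] at this

/-- The torsion profile of the strip of half-width `R`. -/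
noncomputable def stripProfile (R q t : ℝ) : ℝ := (R ^ q - (R - t) ^ q) / q

theorem stripProfile_nonneg {q t : ℝ} (hq : 0 < q) (ht : 0 ≤ t) (htR : t ≤ R) :
    0 ≤ stripProfile R q t := by
  refine div_nonneg (sub_nonneg.2 ?_) hq.le
  exact Real.rpow_le_rpow (by linarith) (by linarith) hq.le

theorem stripProfile_nonpos {q t : ℝ} (hq : 0 < q) (hR : 0 ≤ R) (ht : t ≤ 0) :
    stripProfile R q t ≤ 0 := by
  refine div_nonpos_of_nonpos_of_nonneg (sub_nonpos.2 ?_) hq.le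
  exact Real.rpow_le_rpow hR (by linarith) hq.le

theorem stripProfile_le {q t : ℝ} (hq : 0 < q) (htR : t ≤ R) :
    stripProfile R q t ≤ R ^ q / q := by
  unfold stripProfile
  gcongr
  linarith [Real.rpow_nonneg (by linarith : 0 ≤ R - t) q]

theorem continuous_stripProfile {q : ℝ} (hq : 0 < q) : Continuous (stripProfile R q) := by
  unfold stripProfile
  exact (continuous_const.sub ((continuous_const.sub continuous_id).rpow_const
    fun _ => Or.inr hq.le)).div_const q

/-- Smooth compactly supported approximations of `stripProfile R q (depth R L x)`. -/
noncomputable def smoothProfile (R L q m : ℝ) (x : E 2) : ℝ :=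
  smoothRamp (m * stripProfile R q (softMin (sideDist R L) m x)) / m

section SmoothProfile

variable {q m : ℝ}

theorem softMin_sideDist_lt_R (hm : 0 < m) (x : E 2) : softMin (sideDist R L) m x < R :=
  (softMin_sideDist_lt hm x).trans_le (depth_le x)

/-- The base R - `softMin` stays strictly positive, so the real power q is smooth there. -/
theorem contDiff_stripProfile_softMin (hm : 0 < m) :
    ContDiff ℝ ∞ fun x => stripProfile R q (softMin (sideDist R L) m x) := by
  unfold stripProfile
  refine (contDiff_const.sub (ContDiff.rpow_const_of_ne (contDiff_const.sub
    (contDiff_softMin fun i => contDiff_sideDist i)) fun x => ?_)).div_const q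
  exact (sub_pos.2 (softMin_sideDist_lt_R hm x)).ne'

theorem isTestFunction_smoothProfile (hq : 0 < q) (hR : 0 < R) (hm : 0 < m) :
    IsTestFunction (rectangle R L) (smoothProfile R L q m) := by
  -- The ramp vanishes off K. On K the profile is positive, which forces `softMin` and hence the
  -- depth to be positive.
  set K : Set (E 2) := {x | 1 ≤ m * stripProfile R q (softMin (sideDist R L) m x)} with hK
  have hcl : IsClosed K := isClosed_le continuous_const
    (continuous_const.mul (contDiff_stripProfile_softMin hm).continuous)
  have hKΩ : K ⊆ rectangle R L := fun x hx => by
    refine depth_pos_iff.1 (lt_trans ?_ (softMin_sideDist_lt hm x))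
    by_contra! h
    have h1 : (1 : ℝ) ≤ m * stripProfile R q (softMin (sideDist R L) m x) := hx
    have := mul_nonpos_of_nonneg_of_nonpos hm.le (stripProfile_nonpos hq hR.le h)
    linarith
  have hsub : tsupport (smoothProfile R L q m) ⊆ K := by
    refine closure_minimal (fun x hx => ?_) hcl
    by_contra h
    refine hx ?_
    rw [smoothProfile, smoothRamp_eq_zero (not_le.1 h).le, zero_div]
  refine ⟨?_, ?_, hsub.trans hKΩ⟩
  · exact (contDiff_smoothRamp.comp
      (contDiff_const.mul (contDiff_stripProfile_softMin hm))).div_const m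
  · exact (Metric.isCompact_of_isClosed_isBounded hcl
      (isBounded_rectangle.subset hKΩ)).of_isClosed_subset (isClosed_tsupport _) hsub

theorem smoothProfile_nonneg (hm : 0 < m) (x : E 2) : 0 ≤ smoothProfile R L q m x :=
  div_nonneg (smoothRamp_nonneg _) hm.le

theorem smoothProfile_le (hq : 0 < q) (hR : 0 < R) (hm : 0 < m) (x : E 2) :
    smoothProfile R L q m x ≤ R ^ q / q := by
  have h0 : 0 ≤ R ^ q / q := by positivity
  rw [smoothProfile]
  set y := stripProfile R q (softMin (sideDist R L) m x) with hy
  rcases le_total y 0 with h | h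
  · rw [smoothRamp_eq_zero (by nlinarith), zero_div]
    exact h0
  · refine ((div_le_iff₀' hm).2 (smoothRamp_le (by positivity))).trans ?_
    exact stripProfile_le hq (softMin_sideDist_lt_R hm x).le

theorem tendsto_smoothProfile (hq : 0 < q) {x : E 2} (hx : x ∈ rectangle R L) :
    Tendsto (fun n : ℕ => smoothProfile R L q ((n : ℝ) + 1) x) atTop
      (𝓝 (stripProfile R q (depth R L x))) := by
  have hd := depth_pos_iff.2 hx
  have h1 : Tendsto (fun n : ℕ => stripProfile R q (softMin (sideDist R L) ((n : ℝ) + 1) x)) atTop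
      (𝓝 (stripProfile R q (depth R L x))) :=
    ((continuous_stripProfile hq).tendsto _).comp (tendsto_softMin_sideDist x)
  have h2 := h1.sub (tendsto_one_div_add_atTop_nhds_zero_nat.const_mul (2 : ℝ))
  rw [mul_zero, sub_zero] at h2
  refine tendsto_of_tendsto_of_tendsto_of_le_of_le' h2 h1 (.of_forall fun n => ?_) ?_
  · have hn : (0 : ℝ) < n + 1 := by positivity
    rw [smoothProfile, le_div_iff₀ hn, sub_mul, mul_one_div, div_mul_cancel₀ _ hn.ne']
    rw [mul_comm]
    exact sub_two_le_smoothRamp _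
  · filter_upwards [(tendsto_softMin_sideDist x).eventually_const_lt hd] with n hn
    have hn' : (0 : ℝ) < n + 1 := by positivity
    rw [smoothProfile, div_le_iff₀' hn']
    exact smoothRamp_le (mul_nonneg hn'.le (stripProfile_nonneg hq hn.le
      (softMin_sideDist_lt_R hn' x).le))

/-- Chain rule: the profile has slope (R - t)^(q-1), while the ramp and `softMin` have slopes at
most 1. Where `softMin` ≤ 0 the ramp is flat, so truncation at 0 is harmless. -/
theorem norm_gradient_smoothProfile_le (hq : 1 < q) (hR : 0 < R) (hm : 0 < m) (x : E 2) :
    ‖gradient (smoothProfile R L q m) x‖ ≤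
      (R - max (softMin (sideDist R L) m x) 0) ^ (q - 1) := by
  have hq0 : 0 < q := by linarith
  set σ := softMin (sideDist R L) m with hσ
  have hσR : σ x < R := softMin_sideDist_lt_R hm x
  have hσd : HasFDerivAt σ (fderiv ℝ σ x) x :=
    ((contDiff_softMin (n := 1) fun i => contDiff_sideDist i).differentiable one_ne_zero
      x).hasFDerivAt
  have hσn : ‖fderiv ℝ σ x‖ ≤ 1 := by
    simpa using norm_fderiv_le_of_lipschitz ℝ
      (lipschitzWith_softMin hm fun i => lipschitzWith_sideDist (R := R) (L := L) i) (x₀ := x)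
  have hw : HasDerivAt (stripProfile R q) ((R - σ x) ^ (q - 1)) (σ x) := by
    have h1 : HasDerivAt (fun t => R - t) (-1) (σ x) := by
      simpa using (hasDerivAt_id (σ x)).const_sub R
    have h2 := (h1.rpow_const (p := q) (Or.inl (sub_pos.2 hσR).ne')).const_sub (R ^ q)
      |>.div_const q
    refine h2.congr_deriv ?_
    field_simp
  have hθ : HasDerivAt (fun t => smoothRamp (m * stripProfile R q t) / m)
      (Real.smoothTransition (m * stripProfile R q (σ x) - 1) * (R - σ x) ^ (q - 1)) (σ x) := by
    have := ((hasDerivAt_smoothRamp (m * stripProfile R q (σ x))).comp (σ x)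
      (hw.const_mul m)).div_const m
    refine this.congr_deriv ?_
    field_simp
  have hφ := hθ.comp_hasFDerivAt x hσd
  have hpos : 0 ≤ (R - max (σ x) 0) ^ (q - 1) :=
    Real.rpow_nonneg (sub_nonneg.2 (max_le hσR.le hR.le)) _
  rw [norm_gradient]
  have e : fderiv ℝ (smoothProfile R L q m) x = _ := hφ.fderiv
  rw [e, norm_smul]
  refine (mul_le_of_le_one_right (norm_nonneg _) hσn).trans ?_
  rw [norm_mul, Real.norm_of_nonneg (Real.smoothTransition.nonneg _),
    Real.norm_of_nonneg (Real.rpow_nonneg (sub_pos.2 hσR).le _)]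
  rcases le_total (σ x) 0 with h | h
  · have := mul_nonpos_of_nonneg_of_nonpos hm.le (stripProfile_nonpos hq0 hR.le h)
    rw [Real.smoothTransition.zero_of_nonpos (by linarith), zero_mul]
    exact hpos
  · rw [max_eq_left h]
    exact mul_le_of_le_one_left (Real.rpow_nonneg (sub_pos.2 hσR).le _)
      (Real.smoothTransition.le_one _)

end SmoothProfile

/-- The distance function gives an admissible competitor for the torsional rigidity. -/
theorem integral_stripProfile_depth_le {p : ℝ} (hp : 1 < p) (hR : 0 < R) {u : E 2 → ℝ}
    {G : E 2 → E 2} (h : MemWZero p (rectangle R L) u G)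
    (hE : ∀ (v : E 2 → ℝ) (H : E 2 → E 2), MemWZero p (rectangle R L) v H →
      ∫ x in rectangle R L, ‖G x‖ ^ (p - 2) * inner ℝ (G x) (H x) = ∫ x in rectangle R L, v x) :
    ∫ x in rectangle R L, stripProfile R p.conjExponent (depth R L x) ≤
      (∫ x in rectangle R L, u x) ^ (1 / p.conjExponent) *
        (∫ x in rectangle R L, (R - depth R L x) ^ p.conjExponent) ^ (1 / p) := by
  have hpq := Real.HolderConjugate.conjExponent hp
  set q := p.conjExponent with hq
  have hq0 : 0 < q := hpq.symm.pos
  have hp0 : 0 < p := by linarith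
  have hT : 0 ≤ ∫ x in rectangle R L, u x := by
    rw [integral_eq_integral_norm_rpow_of_weak_solution hp h hE]
    exact integral_nonneg fun x => by positivity
  have hmeas : MeasurableSet (rectangle R L) := isOpen_rectangle.measurableSet
  have hn : ∀ n : ℕ, (0 : ℝ) < n + 1 := fun n => by positivity
  have hφ : ∀ n : ℕ, IsTestFunction (rectangle R L) (smoothProfile R L q ((n : ℝ) + 1)) :=
    fun n => isTestFunction_smoothProfile hq0 hR (hn n)
  have hσc : ∀ n : ℕ, Continuous fun x => softMin (sideDist R L) ((n : ℝ) + 1) x := fun n =>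
    (contDiff_softMin (n := 0) fun i => contDiff_sideDist i).continuous
  have l1 : Tendsto (fun n : ℕ => ∫ x in rectangle R L, smoothProfile R L q ((n : ℝ) + 1) x) atTop
      (𝓝 (∫ x in rectangle R L, stripProfile R q (depth R L x))) := by
    refine tendsto_integral_of_dominated_convergence (fun _ => R ^ q / q)
      (fun n => (hφ n).continuous.aestronglyMeasurable) (integrable_const _)
      (fun n => .of_forall fun x => ?_) ?_
    · rw [Real.norm_of_nonneg (smoothProfile_nonneg (hn n) x)]
      exact smoothProfile_le hq0 hR (hn n) x
    · filter_upwards [ae_restrict_mem hmeas] with x hx using tendsto_smoothProfile hq0 hx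
  have hb : ∀ (n : ℕ) x, 0 ≤ R - max (softMin (sideDist R L) ((n : ℝ) + 1) x) 0 := fun n x =>
    sub_nonneg.2 (max_le (softMin_sideDist_lt_R (hn n) x).le hR.le)
  have hb' : ∀ (n : ℕ) x, (R - max (softMin (sideDist R L) ((n : ℝ) + 1) x) 0) ^ q ≤ R ^ q :=
    fun n x => Real.rpow_le_rpow (hb n x) (sub_le_self _ (le_max_right _ _)) hq0.le
  have hgc : ∀ n : ℕ, Continuous fun x =>
      (R - max (softMin (sideDist R L) ((n : ℝ) + 1) x) 0) ^ q := fun n =>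
    (continuous_const.sub ((hσc n).max continuous_const)).rpow_const fun _ => Or.inr hq0.le
  have l2 : Tendsto (fun n : ℕ => ∫ x in rectangle R L,
      (R - max (softMin (sideDist R L) ((n : ℝ) + 1) x) 0) ^ q) atTop
      (𝓝 (∫ x in rectangle R L, (R - depth R L x) ^ q)) := by
    refine tendsto_integral_of_dominated_convergence (fun _ => R ^ q)
      (fun n => (hgc n).aestronglyMeasurable) (integrable_const _)
      (fun n => .of_forall fun x => ?_) ?_
    · rw [Real.norm_of_nonneg (Real.rpow_nonneg (hb n x) _)]
      exact hb' n x
    · filter_upwards [ae_restrict_mem hmeas] with x hx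
      have hd := (depth_pos_iff.2 hx).le
      have hc : Continuous fun t : ℝ => (R - max t 0) ^ q :=
        (continuous_const.sub (continuous_id.max continuous_const)).rpow_const
          fun _ => Or.inr hq0.le
      have := (hc.tendsto _).comp (tendsto_softMin_sideDist (R := R) (L := L) x)
      rwa [max_eq_left hd] at this
  -- Only the upper bounds for the gradients are passed to the limit, so convergence of the
  -- gradients themselves is not required.
  refine le_of_tendsto_of_tendsto l1
    ((l2.rpow_const (p := 1 / p) (Or.inr (by positivity))).const_mul _) (.of_forall fun n => ?_)
  refine (integral_le_of_weak_solution hp h hE (hφ n)).trans ?_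
  refine mul_le_mul_of_nonneg_left (Real.rpow_le_rpow
    (integral_nonneg fun x => by positivity) ?_ (by positivity)) (by positivity)
  have hi : Integrable (fun x => (R - max (softMin (sideDist R L) ((n : ℝ) + 1) x) 0) ^ q)
      (volume.restrict (rectangle R L)) := by
    refine (integrable_const (R ^ q)).mono' (hgc n).aestronglyMeasurable (.of_forall fun x => ?_)
    rw [Real.norm_of_nonneg (Real.rpow_nonneg (hb n x) _)]
    exact hb' n x
  refine integral_mono_of_nonneg (.of_forall fun x => by positivity) hi (.of_forall fun x => ?_)
  have h1 := Real.rpow_le_rpow (norm_nonneg _)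
    (norm_gradient_smoothProfile_le (L := L) hpq.symm.lt hR (hn n) x) hp0.le
  -- The exponents match because (q - 1)p = q.
  rwa [← Real.rpow_mul (hb n x), hpq.symm.sub_one_mul_conj] at h1

end

/-! ### Explicit integrals over the rectangle. -/

section

variable {R L : ℝ}

theorem measurePreserving_coord_prod :
    MeasurePreserving (fun x : E 2 => (x 0, x 1)) (volume : Measure (E 2)) volume :=
  (volume_preserving_finTwoArrow ℝ).comp (PiLp.volume_preserving_ofLp (Fin 2))

theorem measurableEmbedding_coord_prod : MeasurableEmbedding fun x : E 2 => (x 0, x 1) :=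
  ((MeasurableEquiv.toLp 2 (Fin 2 → ℝ)).symm.trans MeasurableEquiv.finTwoArrow).measurableEmbedding

theorem integral_rectangle (hR : 0 ≤ R) (hL : 0 ≤ L) {F : ℝ → ℝ → ℝ}
    (hF : Continuous (Function.uncurry F)) :
    ∫ x in rectangle R L, F (x 0) (x 1) = ∫ y in (0 : ℝ)..2 * R, ∫ x in (0 : ℝ)..L, F x y := by
  have h := measurePreserving_coord_prod.setIntegral_preimage_emb measurableEmbedding_coord_prod
    (fun z : ℝ × ℝ => F z.1 z.2) (Set.Ioo 0 L ×ˢ Set.Ioo 0 (2 * R))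
  have e : (fun x : E 2 => (x 0, x 1)) ⁻¹' (Set.Ioo 0 L ×ˢ Set.Ioo 0 (2 * R)) = rectangle R L := rfl
  rw [e] at h
  have hi : Integrable (fun z : ℝ × ℝ => F z.1 z.2)
      ((volume.restrict (Set.Ioo 0 L)).prod (volume.restrict (Set.Ioo 0 (2 * R)))) := by
    rw [Measure.prod_restrict]
    exact (hF.continuousOn.integrableOn_compact
      (isCompact_Icc.prod isCompact_Icc)).mono_set
        (Set.prod_mono Set.Ioo_subset_Icc_self Set.Ioo_subset_Icc_self)
  refine h.trans ?_
  rw [Measure.volume_eq_prod, ← Measure.prod_restrict, integral_prod_symm _ hi,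
    intervalIntegral.integral_of_le (by positivity), integral_Ioc_eq_integral_Ioo]
  refine integral_congr_ae (.of_forall fun y => ?_)
  dsimp only
  rw [intervalIntegral.integral_of_le hL, integral_Ioc_eq_integral_Ioo]

theorem integral_comp_min_sub {g : ℝ → ℝ} (hg : Continuous g) {a : ℝ} (ha : 0 ≤ a) :
    ∫ y in (0 : ℝ)..2 * a, g (min y (2 * a - y)) = 2 * ∫ t in (0 : ℝ)..a, g t := by
  have hc : Continuous fun y => g (min y (2 * a - y)) := by fun_prop
  rw [← intervalIntegral.integral_add_adjacent_intervals (hc.intervalIntegrable 0 a)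
    (hc.intervalIntegrable a (2 * a))]
  have h1 : ∫ y in (0 : ℝ)..a, g (min y (2 * a - y)) = ∫ t in (0 : ℝ)..a, g t := by
    refine intervalIntegral.integral_congr fun y hy => ?_
    rw [Set.uIcc_of_le ha] at hy
    simp only [min_eq_left (by linarith [hy.2] : y ≤ 2 * a - y)]
  have h2 : ∫ y in a..2 * a, g (min y (2 * a - y)) = ∫ t in (0 : ℝ)..a, g t := by
    have : ∫ y in a..2 * a, g (min y (2 * a - y)) = ∫ y in a..2 * a, g (2 * a - y) := by
      refine intervalIntegral.integral_congr fun y hy => ?_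
      rw [Set.uIcc_of_le (by linarith)] at hy
      simp only [min_eq_right (by linarith [hy.1] : 2 * a - y ≤ y)]
    rw [this, intervalIntegral.integral_comp_sub_left]
    congr 1 <;> ring
  rw [h1, h2]
  ring

theorem integral_sub_rpow {q t : ℝ} (hq : 0 ≤ q) :
    ∫ s in (0 : ℝ)..t, (R - s) ^ q = (R ^ (q + 1) - (R - t) ^ (q + 1)) / (q + 1) := by
  rw [intervalIntegral.integral_comp_sub_left (fun s => s ^ q), sub_zero,
    integral_rpow (Or.inl (by linarith))]

theorem toReal_volume_rectangle (hR : 0 ≤ R) (hL : 0 ≤ L) :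
    (volume (rectangle R L)).toReal = 2 * L * R := by
  have h := integral_rectangle hR hL (F := fun _ _ => 1) continuous_const
  rw [setIntegral_const, intervalIntegral.integral_const, intervalIntegral.integral_const] at h
  simp only [smul_eq_mul, mul_one, sub_zero, measureReal_def] at h
  rw [h]
  ring

theorem integral_rectangle_abs_rpow (hR : 0 ≤ R) (hL : 0 ≤ L) {q : ℝ} (hq : 0 ≤ q) :
    ∫ x in rectangle R L, |x 1 - R| ^ q = 2 * L * R ^ (q + 1) / (q + 1) := by
  have hc : Continuous fun s : ℝ => s ^ q := continuous_id.rpow_const fun _ => Or.inr hq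
  rw [integral_rectangle hR hL (F := fun _ y => |y - R| ^ q)
    (hc.comp (by fun_prop : Continuous fun z : ℝ × ℝ => |z.2 - R|))]
  simp only [intervalIntegral.integral_const, sub_zero, smul_eq_mul]
  rw [intervalIntegral.integral_const_mul]
  have e : ∀ y, |y - R| ^ q = (R - min y (2 * R - y)) ^ q := fun y => by
    congr 1
    rcases le_total y R with h | h
    · rw [min_eq_left (by linarith), abs_of_nonpos (by linarith)]; ring
    · rw [min_eq_right (by linarith), abs_of_nonneg (by linarith)]; ring
  simp only [e]
  rw [integral_comp_min_sub (g := fun t => (R - t) ^ q)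
    (hc.comp (continuous_const.sub continuous_id)) hR, integral_sub_rpow hq, sub_self,
    Real.zero_rpow (by linarith)]
  ring

/-- On a horizontal slice, t is the distance to the nearer horizontal side. In the half-slice x ≤
L/2 the vertical side is nearer up to x = t and the horizontal one beyond; t ≤ R ≤ L/2 makes the
split legitimate. -/
theorem integral_min_sub_rpow {q t : ℝ} (hq : 0 ≤ q) (ht : 0 ≤ t) (htR : t ≤ R)
    (hL : 2 * R ≤ L) : ∫ x in (0 : ℝ)..L, (R - min (min x (L - x)) t) ^ q =
      2 * ((R ^ (q + 1) - (R - t) ^ (q + 1)) / (q + 1) + (L / 2 - t) * (R - t) ^ q) := by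
  have hc : Continuous fun s : ℝ => (R - min s t) ^ q :=
    (by fun_prop : Continuous fun s : ℝ => R - min s t).rpow_const fun _ => Or.inr hq
  have h1 := integral_comp_min_sub hc (by linarith : 0 ≤ L / 2)
  rw [mul_div_cancel₀ L two_ne_zero] at h1
  rw [h1, ← intervalIntegral.integral_add_adjacent_intervals (hc.intervalIntegrable 0 t)
    (hc.intervalIntegrable t (L / 2)), ← integral_sub_rpow hq]
  congr 2
  · refine intervalIntegral.integral_congr fun x hx => ?_
    rw [Set.uIcc_of_le ht] at hx
    simp only [min_eq_left hx.2]
  · rw [← smul_eq_mul, ← intervalIntegral.integral_const]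
    refine intervalIntegral.integral_congr fun x hx => ?_
    rw [Set.uIcc_of_le (by linarith)] at hx
    simp only [min_eq_right hx.1]

theorem integral_rectangle_depth_rpow (hR : 0 < R) (hL : 2 * R ≤ L) {q : ℝ} (hq : 0 ≤ q) :
    ∫ x in rectangle R L, (R - depth R L x) ^ q =
      2 * (L - 2 * R) * R ^ (q + 1) / (q + 1) + 8 * R ^ (q + 2) / (q + 2) := by
  have hpow : ∀ {r : ℝ}, 0 ≤ r → Continuous fun s : ℝ => (R - s) ^ r := fun hr =>
    (continuous_const.sub continuous_id).rpow_const fun _ => Or.inr hr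
  have h := integral_rectangle hR.le (by linarith : 0 ≤ L)
    (F := fun x y => (R - min (min x (L - x)) (min y (2 * R - y))) ^ q)
    ((hpow hq).comp (by fun_prop :
      Continuous fun z : ℝ × ℝ => min (min z.1 (L - z.1)) (min z.2 (2 * R - z.2))))
  refine h.trans ?_
  set g : ℝ → ℝ := fun t => 2 * ((R ^ (q + 1) - (R - t) ^ (q + 1)) / (q + 1) +
    (L / 2 - t) * (R - t) ^ q) with hg
  have e1 : ∫ y in (0 : ℝ)..2 * R, ∫ x in (0 : ℝ)..L,
      (R - min (min x (L - x)) (min y (2 * R - y))) ^ q =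
      ∫ y in (0 : ℝ)..2 * R, g (min y (2 * R - y)) := by
    refine intervalIntegral.integral_congr fun y hy => ?_
    rw [Set.uIcc_of_le (by linarith)] at hy
    refine integral_min_sub_rpow hq (le_min hy.1 (by linarith [hy.2])) ?_ hL
    rcases le_total y R with h | h
    · exact (min_le_left _ _).trans h
    · exact (min_le_right _ _).trans (by linarith)
  have hc1 := hpow (by linarith : 0 ≤ q + 1)
  have hc0 := hpow hq
  have hgc : Continuous g := by fun_prop
  rw [e1, integral_comp_min_sub hgc hR.le]
  -- Writing L - 2t = (L - 2R) + 2(R - t) turns the integrand into pure powers of R - t.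
  have e2 : ∫ t in (0 : ℝ)..R, g t =
      ∫ t in (0 : ℝ)..R, (2 * R ^ (q + 1) / (q + 1) + (2 - 2 / (q + 1)) * (R - t) ^ (q + 1) +
        (L - 2 * R) * (R - t) ^ q) := by
    refine intervalIntegral.integral_congr fun t ht => ?_
    rw [Set.uIcc_of_le hR.le] at ht
    have : (R - t) ^ (q + 1) = (R - t) ^ q * (R - t) :=
      Real.rpow_add_one' (by linarith [ht.2]) (by linarith)
    simp only [hg, this]
    field_simp
    ring
  have i1 : IntervalIntegrable (fun t => (2 - 2 / (q + 1)) * (R - t) ^ (q + 1)) volume 0 R :=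
    (hc1.const_mul _).intervalIntegrable 0 R
  have i2 : IntervalIntegrable (fun t => (L - 2 * R) * (R - t) ^ q) volume 0 R :=
    (hc0.const_mul _).intervalIntegrable 0 R
  rw [e2, intervalIntegral.integral_add (intervalIntegrable_const.add i1) i2,
    intervalIntegral.integral_add intervalIntegrable_const i1,
    intervalIntegral.integral_const_mul, intervalIntegral.integral_const_mul,
    intervalIntegral.integral_const, integral_sub_rpow hq,
    integral_sub_rpow (by linarith), sub_self, Real.zero_rpow (by linarith),
    Real.zero_rpow (by linarith), smul_eq_mul]
  have : R ^ (q + 2) = R ^ (q + 1) * R := by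
    rw [← Real.rpow_add_one hR.ne']
    ring_nf
  rw [show q + 1 + 1 = q + 2 by ring, this]
  field_simp
  ring

/-- By definition of the profile this integral equals (|Ω| R^q - W)/q, with W the integral of (R -
d)^q. -/
theorem integral_rectangle_stripProfile_depth (hR : 0 < R) (hL : 2 * R ≤ L) {q : ℝ} (hq : 0 < q) :
    ∫ x in rectangle R L, stripProfile R q (depth R L x) =
      2 * (L - 2 * R) * R ^ (q + 1) / (q + 1) + 4 * R ^ (q + 2) / (q + 2) := by
  have hi : Integrable (fun x => (R - depth R L x) ^ q) (volume.restrict (rectangle R L)) := by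
    have hc : Continuous fun x => (R - depth R L x) ^ q :=
      (continuous_const.sub continuous_depth).rpow_const fun _ => Or.inr hq.le
    refine (integrable_const (R ^ q)).mono' hc.aestronglyMeasurable ?_
    filter_upwards [ae_restrict_mem isOpen_rectangle.measurableSet] with x hx
    have h1 := sub_nonneg.2 (depth_le (R := R) (L := L) x)
    rw [Real.norm_of_nonneg (Real.rpow_nonneg h1 _)]
    exact Real.rpow_le_rpow h1 (by linarith [depth_pos_iff.2 hx]) hq.le
  unfold stripProfile
  rw [integral_div, integral_sub (integrable_const _) hi, setIntegral_const,
    integral_rectangle_depth_rpow hR hL hq.le, measureReal_def,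
    toReal_volume_rectangle hR.le (by linarith), smul_eq_mul]
  have h1 : R ^ (q + 2) = R ^ q * R ^ 2 := by
    rw [Real.rpow_add hR, Real.rpow_two]
  rw [h1, Real.rpow_add_one hR.ne']
  field_simp
  ring

end

/-! ### Bounds for the rigidity, for Q and for the ratio. -/

section

variable {R L p κ : ℝ}

theorem inradius_rectangle (hR : 0 < R) (hL : 2 * R ≤ L) : inradius (rectangle R L) = R := by
  refine IsGreatest.csSup_eq ⟨⟨hR.le, !₂[L / 2, R], fun y hy => ?_⟩, ?_⟩
  · have h : ∀ i : Fin 2, |y i - (!₂[L / 2, R] : E 2) i| < R := fun i => by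
      have := PiLp.norm_apply_le (y - (!₂[L / 2, R] : E 2)) i
      exact this.trans_lt (by rwa [← dist_eq_norm])
    have h0 := abs_lt.1 (h 0)
    have h1 := abs_lt.1 (h 1)
    simp only [Matrix.cons_val_zero, Matrix.cons_val_one] at h0 h1
    exact ⟨⟨by linarith, by linarith⟩, by linarith, by linarith⟩
  · rintro r ⟨-, x, hx⟩
    by_contra! hr
    -- With R < s < r, the points x ± s e₁ lie in the ball, but their second coordinates differ by
    -- 2s > 2R.
    set s := (r + R) / 2 with hs
    have hmem : ∀ t : ℝ, |t| < r → x + EuclideanSpace.single 1 t ∈ rectangle R L := fun t ht => by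
      refine hx ?_
      rw [mem_ball_iff_norm, add_sub_cancel_left, PiLp.norm_single, Real.norm_eq_abs]
      exact ht
    have hs0 : 0 < s := by linarith
    have h1 := (hmem s (by rw [abs_of_pos hs0]; linarith)).2.2
    have h2 := (hmem (-s) (by rw [abs_neg, abs_of_pos hs0]; linarith)).2.1
    simp at h1 h2
    linarith

/-- Both differences are explicit. The first is strictly positive, and this is where the strict
upper bound on Q originates; the second is a multiple of L - 2R, which vanishes for a square. -/
theorem integral_competitor_bounds (hR : 0 < R) (hL : 2 * R ≤ L) {q V W : ℝ} (hq : 0 < q)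
    (hV : V = 2 * (L - 2 * R) * R ^ (q + 1) / (q + 1) + 4 * R ^ (q + 2) / (q + 2))
    (hW : W = 2 * (L - 2 * R) * R ^ (q + 1) / (q + 1) + 8 * R ^ (q + 2) / (q + 2)) :
    0 < V ∧ 2 * L * R ^ (q + 1) / (q + 1) < W ∧ W ≤ V * (1 + 2 * R / L) := by
  have hL0 : 0 < L := by linarith
  have h2 : R ^ (q + 2) = R ^ (q + 1) * R := by
    rw [← Real.rpow_add_one hR.ne']
    ring_nf
  have hP : 0 < R ^ (q + 1) := Real.rpow_pos_of_pos hR _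
  rw [h2] at hV hW
  generalize R ^ (q + 1) = P at *
  have hLR : 0 ≤ L - 2 * R := by linarith
  refine ⟨by rw [hV]; positivity, ?_, ?_⟩
  · have : W - 2 * L * P / (q + 1) = 4 * q * P * R / ((q + 1) * (q + 2)) := by
      rw [hW]; field_simp; ring
    have h3 : 0 < 4 * q * P * R / ((q + 1) * (q + 2)) := by positivity
    linarith
  · have : V * (1 + 2 * R / L) - W = 4 * R * P * (L - 2 * R) / (L * (q + 1) * (q + 2)) := by
      rw [hV, hW]; field_simp; ring
    have h3 : 0 ≤ 4 * R * P * (L - 2 * R) / (L * (q + 1) * (q + 2)) := by positivity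
    linarith

/-- Two-sided bounds for the `p`-torsional rigidity of a rectangle. -/
theorem torsionalRigidity_rectangle_bounds (hp : 1 < p) (hR : 0 < R) (hL : 2 * R ≤ L) :
    0 < torsionalRigidity p (rectangle R L) ∧
    torsionalRigidity p (rectangle R L) ≤
      2 * L * R ^ (p.conjExponent + 1) / (p.conjExponent + 1) ∧
    2 * L * R ^ (p.conjExponent + 1) / (p.conjExponent + 1) <
      torsionalRigidity p (rectangle R L) * (1 + 2 * R / L) ^ p.conjExponent := by
  have hpq := Real.HolderConjugate.conjExponent hp
  set q := p.conjExponent with hq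
  have hq0 : 0 < q := hpq.symm.pos
  have hp0 : 0 < p := by linarith
  have hL0 : 0 < L := by linarith
  have hΩ : ∀ x ∈ rectangle R L, |x 1 - R| ≤ R := fun x hx => by
    rw [abs_le]
    constructor <;> linarith [hx.2.1, hx.2.2]
  obtain ⟨G, h, hE⟩ := isTorsionFunction_torsionFunction
    (exists_isTorsionFunction (p := p) hp hΩ hR.le)
  have hup := integral_le_integral_coord_rpow_of_weak_solution isOpen_rectangle.measurableSet hp
    h hE hΩ
  have hlow := integral_stripProfile_depth_le hp hR h hE
  have hT : 0 ≤ torsionalRigidity p (rectangle R L) := by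
    rw [torsionalRigidity, integral_eq_integral_norm_rpow_of_weak_solution hp h hE]
    exact integral_nonneg fun x => by positivity
  rw [← torsionalRigidity] at hup hlow
  rw [integral_rectangle_abs_rpow hR.le hL0.le hq0.le] at hup
  set T := torsionalRigidity p (rectangle R L)
  set V := ∫ x in rectangle R L, stripProfile R q (depth R L x) with hV
  set W := ∫ x in rectangle R L, (R - depth R L x) ^ q with hW
  rw [integral_rectangle_stripProfile_depth hR hL hq0] at hV
  rw [integral_rectangle_depth_rpow hR hL hq0.le] at hW
  obtain ⟨hV0, hSW, hWV⟩ := integral_competitor_bounds hR hL hq0 hV hW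
  set S := 2 * L * R ^ (q + 1) / (q + 1)
  have hS0 : 0 < S := by positivity
  have hW0 : 0 < W := hS0.trans hSW
  have hTpos : 0 < T := by
    refine hT.lt_of_ne fun h0 => ?_
    rw [← h0, Real.zero_rpow (by positivity), zero_mul] at hlow
    linarith
  refine ⟨hTpos, hup, ?_⟩
  set c := 1 + 2 * R / L
  have hc0 : 0 < c := by positivity
  -- Raise the competitor inequality to the power q and use q/p = q - 1.
  have hVq : V ^ q ≤ T * W ^ (q - 1) := by
    have := Real.rpow_le_rpow hV0.le hlow hq0.le
    rwa [Real.mul_rpow (by positivity) (by positivity), ← Real.rpow_mul hT, ← Real.rpow_mul hW0.le,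
      one_div_mul_cancel hq0.ne', Real.rpow_one, one_div_mul_eq_div,
      hpq.symm.div_conj_eq_sub_one] at this
  have hWq : W ^ q ≤ V ^ q * c ^ q := by
    rw [← Real.mul_rpow hV0.le hc0.le]
    exact Real.rpow_le_rpow hW0.le hWV hq0.le
  have hWs : W ^ q = W * W ^ (q - 1) := by
    rw [Real.rpow_sub_one hW0.ne', mul_div_cancel₀ _ hW0.ne']
  have hWp : 0 < W ^ (q - 1) := Real.rpow_pos_of_pos hW0 _
  have hcp : 0 < c ^ q := Real.rpow_pos_of_pos hc0 _
  refine lt_of_mul_lt_mul_right ?_ hWp.le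
  calc S * W ^ (q - 1) < W * W ^ (q - 1) := by gcongr
    _ = W ^ q := hWs.symm
    _ ≤ V ^ q * c ^ q := hWq
    _ ≤ T * W ^ (q - 1) * c ^ q := by gcongr
    _ = T * c ^ q * W ^ (q - 1) := by ring

/-- The expression under the root is (S/T)^(p-1), because R^p = (R^q)^(p-1) and (2p-1)/(p-1) = q +
1. The outer exponent combines as (p-1)/p = 1/q. -/
theorem Q_rectangle (hp : 1 < p) (hR : 0 < R) (hL : 2 * R ≤ L) :
    Q p (rectangle R L) = (2 * L * R ^ (p.conjExponent + 1) / (p.conjExponent + 1) /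
      torsionalRigidity p (rectangle R L)) ^ (1 / p.conjExponent) := by
  have hpq := Real.HolderConjugate.conjExponent hp
  have hT := (torsionalRigidity_rectangle_bounds hp hR hL).1
  rw [Q, normalizedRigidity, inradius_rectangle hR hL,
    toReal_volume_rectangle hR.le (by linarith)]
  set T := torsionalRigidity p (rectangle R L)
  have hL0 : 0 < L := by linarith
  have e1 : (2 * p - 1) / (p - 1) = p.conjExponent + 1 := by
    have : p - 1 ≠ 0 := by linarith
    rw [Real.conjExponent]
    field_simp
    ring
  set q := p.conjExponent
  have hq0 : 0 < q := hpq.symm.pos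
  have e2 : R ^ p = (R ^ q) ^ (p - 1) := by
    rw [← Real.rpow_mul hR.le, mul_comm, hpq.sub_one_mul_conj]
  have e3 : T ^ (1 - p) = (T ^ (p - 1))⁻¹ := by
    rw [← Real.rpow_neg hT.le, neg_sub]
  have e4 : 1 / q = (p - 1) * (1 / p) := by
    have := hpq.inv_add_inv_eq_one
    field_simp at this ⊢
    linarith
  rw [e1, e2, e3, e4, Real.rpow_mul (by positivity)]
  congr 1
  rw [Real.div_rpow (by positivity) hT.le, Real.div_rpow (by positivity) (by positivity),
    Real.rpow_add_one hR.ne', show 2 * L * (R ^ q * R) = 2 * L * R * R ^ q by ring,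
    Real.mul_rpow (by positivity : 0 ≤ 2 * L * R) (by positivity)]
  field_simp

theorem Q_rectangle_bounds (hp : 1 < p) (hR : 0 < R) (hL : 2 * R ≤ L) :
    1 ≤ Q p (rectangle R L) ∧ Q p (rectangle R L) < 1 + 2 * R / L := by
  have hq0 : 0 < p.conjExponent := (Real.HolderConjugate.conjExponent hp).symm.pos
  have hL0 : 0 < L := by linarith
  obtain ⟨hT, hup, hlow⟩ := torsionalRigidity_rectangle_bounds hp hR hL
  rw [Q_rectangle hp hR hL]
  refine ⟨Real.one_le_rpow ((one_le_div hT).2 hup) (by positivity), ?_⟩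
  rw [one_div, Real.rpow_inv_lt_iff_of_pos (by positivity) (by positivity) hq0, div_lt_iff₀' hT]
  exact hlow

theorem Q_mem_rectangleFamily_bounds (hp : 1 < p) (hκ : 2 ≤ κ) {Ω : Set (E 2)}
    (hΩ : Ω ∈ rectangleFamily κ) : 1 ≤ Q p Ω ∧ Q p Ω < 1 + 2 / κ := by
  obtain ⟨R, L, hR, hL, h, rfl⟩ := hΩ
  have h1 : κ * R ≤ L := (le_div_iff₀ hR).1 h
  have h2 : 2 * R ≤ L := (mul_le_mul_of_nonneg_right hκ hR.le).trans h1
  have h3 : 2 * R / L ≤ 2 / κ := by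
    rw [div_le_div_iff₀ hL (by linarith)]
    linarith
  obtain ⟨h4, h5⟩ := Q_rectangle_bounds hp hR h2
  exact ⟨h4, by linarith⟩

theorem le_familyRatio_rectangleFamily (hp : 1 < p) (hκ : 2 ≤ κ) :
    κ / (κ + 2) ≤ familyRatio (rectangleFamily κ) p := by
  have hne : (Q p '' rectangleFamily κ).Nonempty :=
    ⟨_, rectangle 1 κ, ⟨1, κ, one_pos, by linarith, by simp, rfl⟩, rfl⟩
  have hinf : 1 ≤ familyInf (rectangleFamily κ) p := by
    refine le_csInf hne ?_
    rintro _ ⟨Ω, hΩ, rfl⟩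
    exact (Q_mem_rectangleFamily_bounds hp hκ hΩ).1
  have hub : ∀ y ∈ Q p '' rectangleFamily κ, y ≤ 1 + 2 / κ := by
    rintro _ ⟨Ω, hΩ, rfl⟩
    exact (Q_mem_rectangleFamily_bounds hp hκ hΩ).2.le
  have hsup : familySup (rectangleFamily κ) p ≤ 1 + 2 / κ := csSup_le hne hub
  -- Boundedness above is needed here, since `sSup` of an unbounded set of reals would be 0.
  have hsup0 : 0 < familySup (rectangleFamily κ) p := by
    obtain ⟨y, hy⟩ := hne
    have h1 : y ≤ familySup (rectangleFamily κ) p := le_csSup ⟨_, hub⟩ hy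
    obtain ⟨Ω, hΩ, rfl⟩ := hy
    linarith [(Q_mem_rectangleFamily_bounds hp hκ hΩ).1]
  rw [familyRatio, le_div_iff₀ hsup0]
  refine le_trans ?_ hinf
  calc κ / (κ + 2) * familySup (rectangleFamily κ) p ≤ κ / (κ + 2) * (1 + 2 / κ) := by gcongr
    _ = 1 := by field_simp

end

end PTorsion

theorem mainTheorem8 (p κ : ℝ) (hp : 1 < p) (hκ : 2 ≤ κ) :
    (∀ Ω ∈ PTorsion.rectangleFamily κ, 1 ≤ PTorsion.Q p Ω ∧ PTorsion.Q p Ω < 1 + 2 / κ) ∧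
    κ / (κ + 2) ≤ PTorsion.familyRatio (PTorsion.rectangleFamily κ) p := by
  exact ⟨fun _ hΩ => PTorsion.Q_mem_rectangleFamily_bounds hp hκ hΩ,
    PTorsion.le_familyRatio_rectangleFamily hp hκ⟩
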